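/- For a real number $\alpha\ge 1$ put $\mathrm{brute}(\alpha)=1+\exp\left(-\alpha\, H(1/\alpha)\right)$, where $H(p)=-p\ln p-(1-p)\ln(1-p)$ (with $0\ln 0=0$). A family $\mathcal F\subseteq 2^{[n]}$ is monotone if $[n]\in\mathcal F$ and $S\subseteq T\subseteq[n]$, $S\in\mathcal F$ imply $T\in\mathcal F$. A (deterministic or randomized) oracle $\alpha$-approximation minimum subset algorithm receives the universe $[n]$ and a membership oracle for a monotone family $\mathcal F\subseteq 2^{[n]}$, and returns a set $S\in\mathcal F$ with $|S|\le\alpha\cdot\min\{|T| : T\in\mathcal F\}$; if it is randomized, it does so with probability at least $\gamma$, for a constant $\gamma>0$ that does not depend on $n$ and $\mathcal F$. We write $f(n)=O^*(c^n)$ if $f(n)=O(n^d c^n)$ for some $d\in\mathbb N$. Then for every real $\alpha\ge 1$: (1) There is a deterministic oracle $\alpha$-approximation minimum subset algorithm with running time $O^*(\mathrm{brute}(\alpha)^n)$. Here an algorithm is one program, for all $n$, of a random access machine with logarithmic cost that has the operations $+$, truncated $-$, $\times$, rounded division, multiplication by the constant $\alpha$ rounded down ($k\mapsto\lfloor\alpha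 k\rfloor$), indirect addressing, and membership queries for sets given by their characteristic bit vectors. (2) For no real $c$ with $0\le c<\mathrm{brute}(\alpha)$ is there a randomized oracle $\alpha$-approximation minimum subset algorithm that always uses at most $O^*(c^n)$ oracle queries. This holds even if computation other than queries is free and the algorithm may be a different one for each $n$. -/

import Mathlib

namespace OracleMinSubset

/-! ### Monotone families, approximate minimum solutions, growth rates -/

/-- A family of subsets of the universe `[n]` is monotone if it contains the whole universe and
is closed under taking supersets. -/
def MonotoneFamily {n : ℕ} (F : Set (Finset (Fin n))) : Prop :=
  Finset.univ ∈ F ∧ ∀ S T : Finset (Fin n), S ⊆ T → S ∈ F → T ∈ F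

/-- `S` is an `α`-approximate minimum solution for `F`: it is a member of `F` and its size is at
most `α` times the size of every member of `F`, hence at most `α` times the minimum size. -/
def IsApproxSolution {n : ℕ} (α : ℝ) (F : Set (Finset (Fin n))) (S : Finset (Fin n)) : Prop :=
  S ∈ F ∧ ∀ T ∈ F, (S.card : ℝ) ≤ α * (T.card : ℝ)

/-- `f(n) = O*(c ^ n)`: `f(n)` is at most `c ^ n` up to a factor polynomial in `n`. -/
def OStar (f : ℕ → ℕ) (c : ℝ) : Prop :=
  ∃ d : ℕ, (fun n : ℕ => (f n : ℝ)) =O[Filter.atTop] (fun n : ℕ => (n : ℝ) ^ d * c ^ n)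

/-- `1 + exp (-α H(1/α))`, where `H(p) = -p ln p - (1 - p) ln (1 - p)`. -/
noncomputable def brute (α : ℝ) : ℝ :=
  1 + Real.exp (-α * Real.binEntropy (1 / α))

/-! ### Deterministic algorithms: a random access machine with a membership oracle

Programs are structured programs over an unbounded memory of natural numbers with indirect
addressing. Running time is measured by the logarithmic cost criterion: an instruction costs one
plus the lengths of the addresses and numbers that it handles. -/

/-- The memory of the machine. -/
abbrev Memory : Type := ℕ → ℕ

/-- The subset of `[n]` that a number encodes: `i` is an element iff bit `i` is one. -/
def decode (n x : ℕ) : Finset (Fin n) :=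
  Finset.univ.filter (fun i : Fin n => x.testBit i = true)

/-- Elementary instructions. The arguments are addresses of memory cells, except for the second
argument of `const`, which is the constant itself. -/
inductive Instr : Type where
  | const (d c : ℕ)
  | copy (d a : ℕ)
  | add (d a b : ℕ)
  | sub (d a b : ℕ)
  | mul (d a b : ℕ)
  | div (d a b : ℕ)
  | scale (d a : ℕ)
  | load (d a : ℕ)
  | store (a b : ℕ)
  | query (d a : ℕ)

open Classical in
/-- The effect of an elementary instruction, for approximation ratio `α` and membership oracle
`F`. Subtraction is truncated and division rounds down. The instruction `scale` multiplies by the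
constant `α` and rounds down; it is the access that a program has to the real number `α`. -/
noncomputable def Instr.eval (α : ℝ) {n : ℕ} (F : Set (Finset (Fin n))) :
    Instr → Memory → Memory
  | .const d c, m => Function.update m d c
  | .copy d a, m => Function.update m d (m a)
  | .add d a b, m => Function.update m d (m a + m b)
  | .sub d a b, m => Function.update m d (m a - m b)
  | .mul d a b, m => Function.update m d (m a * m b)
  | .div d a b, m => Function.update m d (m a / m b)
  | .scale d a, m => Function.update m d ⌊α * (m a : ℝ)⌋₊
  | .load d a, m => Function.update m d (m (m a))
  | .store a b, m => Function.update m (m a) (m b)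
  | .query d a, m => Function.update m d (if decode n (m a) ∈ F then 1 else 0)

/-- The logarithmic cost of an elementary instruction; `Nat.size` is the length in binary. -/
noncomputable def Instr.cost (α : ℝ) : Instr → Memory → ℕ
  | .const _ c, _ => 1 + c.size
  | .copy _ a, m => 1 + (m a).size
  | .add _ a b, m => 1 + (m a).size + (m b).size
  | .sub _ a b, m => 1 + (m a).size + (m b).size
  | .mul _ a b, m => 1 + (m a).size + (m b).size
  | .div _ a b, m => 1 + (m a).size + (m b).size
  | .scale _ a, m => 1 + (m a).size + (⌊α * (m a : ℝ)⌋₊).size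
  | .load _ a, m => 1 + (m a).size + (m (m a)).size
  | .store a b, m => 1 + (m a).size + (m b).size
  | .query _ a, m => 1 + (m a).size

/-- Programs. The conditions of `ite` and `loop` ask whether a memory cell is nonzero. -/
inductive Program : Type where
  | skip
  | instr (i : Instr)
  | seq (P Q : Program)
  | ite (a : ℕ) (P Q : Program)
  | loop (a : ℕ) (P : Program)

/-- `Exec α F P m m' t`: started in memory `m`, the program `P` halts with memory `m'` after
time `t`, given the membership oracle `F`. -/
inductive Exec (α : ℝ) {n : ℕ} (F : Set (Finset (Fin n))) :
    Program → Memory → Memory → ℕ → Prop where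
  | skip (m : Memory) : Exec α F .skip m m 1
  | instr (i : Instr) (m : Memory) : Exec α F (.instr i) m (i.eval α F m) (i.cost α m)
  | seq {P Q : Program} {m m' m'' : Memory} {t t' : ℕ} :
      Exec α F P m m' t → Exec α F Q m' m'' t' → Exec α F (.seq P Q) m m'' (t + t')
  | ite_true {a : ℕ} {P Q : Program} {m m' : Memory} {t : ℕ} :
      m a ≠ 0 → Exec α F P m m' t → Exec α F (.ite a P Q) m m' (1 + (m a).size + t)
  | ite_false {a : ℕ} {P Q : Program} {m m' : Memory} {t : ℕ} :
      m a = 0 → Exec α F Q m m' t → Exec α F (.ite a P Q) m m' (1 + (m a).size + t)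
  | loop_step {a : ℕ} {P : Program} {m m' m'' : Memory} {t t' : ℕ} :
      m a ≠ 0 → Exec α F P m m' t → Exec α F (.loop a P) m' m'' t' →
        Exec α F (.loop a P) m m'' (1 + (m a).size + t + t')
  | loop_done {a : ℕ} {P : Program} {m : Memory} :
      m a = 0 → Exec α F (.loop a P) m m (1 + (m a).size)

/-- The initial memory: cell `0` holds the size of the universe, all other cells hold `0`. -/
def initMemory (n : ℕ) : Memory := Function.update (fun _ => 0) 0 n

/-- `P` is a deterministic oracle `α`-approximation minimum subset algorithm with running time
at most `T`: on every universe `[n]` and for every monotone family, given as an oracle, it halts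
within time `T n` and cell `0` then encodes an `α`-approximate minimum solution. -/
def IsDeterministicApprox (α : ℝ) (P : Program) (T : ℕ → ℕ) : Prop :=
  ∀ (n : ℕ) (F : Set (Finset (Fin n))), MonotoneFamily F →
    ∃ (m : Memory) (t : ℕ), Exec α F P (initMemory n) m t ∧ t ≤ T n ∧
      IsApproxSolution α F (decode n (m 0))

/-! ### Randomized algorithms: distributions on adaptive query strategies

Only the oracle queries are counted. All other computation is free, and the algorithm may be a
different one for each universe, so this covers every randomized model of computation. -/

/-- A strategy for a universe `[n]` and fixed random bits: it either returns a set, or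
queries a set and continues according to the answer, positive or negative. -/
inductive QueryTree (n : ℕ) : Type where
  | output (S : Finset (Fin n)) : QueryTree n
  | query (S : Finset (Fin n)) (pos neg : QueryTree n) : QueryTree n

open Classical in
/-- The set that is returned when the oracle is `F`. -/
noncomputable def QueryTree.run {n : ℕ} (F : Set (Finset (Fin n))) :
    QueryTree n → Finset (Fin n)
  | .output S => S
  | .query S pos neg => if S ∈ F then pos.run F else neg.run F

open Classical in
/-- The number of queries that are made when the oracle is `F`. -/
noncomputable def QueryTree.queries {n : ℕ} (F : Set (Finset (Fin n))) : QueryTree n → ℕ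
  | .output _ => 0
  | .query S pos neg => 1 + if S ∈ F then pos.queries F else neg.queries F

/-- A randomized oracle algorithm: for every universe, the probability distribution of the
strategy that is determined by the random bits. -/
abbrev RandomizedAlgorithm : Type := (n : ℕ) → PMF (QueryTree n)

/-- `A` is a randomized oracle `α`-approximation minimum subset algorithm: for some constant
`γ > 0`, on every universe and for every monotone family, it returns an `α`-approximate minimum
solution with probability at least `γ`. -/
def IsRandomizedApprox (α : ℝ) (A : RandomizedAlgorithm) : Prop :=
  ∃ γ : ENNReal, 0 < γ ∧ ∀ (n : ℕ) (F : Set (Finset (Fin n))), MonotoneFamily F →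
    γ ≤ (A n).toOuterMeasure {t | IsApproxSolution α F (t.run F)}

/-- `A` never makes more than `q n` queries on the universe `[n]` with a monotone family. -/
def UsesAtMostQueries (A : RandomizedAlgorithm) (q : ℕ → ℕ) : Prop :=
  ∀ (n : ℕ) (F : Set (Finset (Fin n))), MonotoneFamily F →
    ∀ t ∈ (A n).support, t.queries F ≤ q n

end OracleMinSubset

/-! Put w = `weight α`, so that `brute α ^ n` is the sum of C(n,k) w^k over k. For α > 1 and s =
⌊αk⌋, the number C(s,k) (1/α)^k (1-1/α)^(s-k) is a term of a binomial distribution, hence at most 1,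
and it is the largest term, hence at least 1/(s+1). Therefore w^k is 1/C(⌊αk⌋,k) up to a polynomial
factor (`choose_mul_weight_pow_le_one`, `one_le_choose_mul_weight_pow`), and `brute α ^ n` is
governed by the quotients C(n,k)/C(⌊αk⌋,k).

Lower bound: compare the family of all sets larger than s with the family in which a k-set T and its
supersets are planted. A strategy that succeeds on the planted family must visit, when run on the
unplanted one, a set of size at most s that contains T. Such a set serves at most C(s,k) choices of
T, so q queries serve at most (q+1) C(s,k) of the C(n,k) choices (`card_solved_le`). Averaging over
T handles random bits, and summing over k gives `brute_pow_le_of_isRandomizedApprox`.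

Upper bound: call S a cover of T if S contains T and |S| ≤ α|T|. If a list of sets covers every
subset of the universe, then its smallest member of the family is an α-approximation, by
monotonicity. To find a list fast, split the universe into a constant number r of blocks of size k.
On one block, double counting shows that some set covers at least a 1/W fraction of any collection
of subsets, where W = `coverWeight α k` is `brute α ^ k` up to a polynomial factor
(`card_le_mul_coverWeight`). The greedy algorithm thus finds a list of length at most Wk + 1
(`IsGreedy.step`), in time about 16^k. Products of r covers cover all subsets of the whole universe
(`IsGreedy.exists_word_covers`), and there are about `brute α ^ (r * k)` of them. Choosing r with 16
≤ `brute α ^ r` makes the greedy phase affordable.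

The remainder is a verification of a concrete program: `Ends` is a Hoare triple with a step count,
in which all numbers have linearly many bits, so that logarithmic cost adds only a polynomial
factor. -/

namespace OracleMinSubset

open Finset

/-! ### Binomial estimates for `brute` -/

/-- The weight of an element in the expansion `brute α ^ n = ∑ k, n.choose k * weight α ^ k`. -/
noncomputable def weight (α : ℝ) : ℝ := Real.exp (-α * Real.binEntropy (1 / α))

lemma weight_pos (α : ℝ) : 0 < weight α := Real.exp_pos _

lemma brute_eq_one_add_weight (α : ℝ) : brute α = 1 + weight α := rfl

lemma one_lt_brute (α : ℝ) : 1 < brute α := by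
  rw [brute_eq_one_add_weight]; linarith [weight_pos α]

lemma weight_one : weight 1 = 1 := by simp [weight]

lemma weight_eq_rpow {α : ℝ} (hα : 1 < α) :
    weight α = 1 / α * (1 - 1 / α) ^ (α - 1) := by
  have h0 : 0 < α := by linarith
  have hp : 0 < 1 / α := by positivity
  have hq : 0 < 1 - 1 / α := by
    have : 1 / α < 1 := by rw [div_lt_one h0]; exact hα
    linarith
  rw [Real.rpow_def_of_pos hq, weight]
  have e : 1 / α * Real.exp (Real.log (1 - 1 / α) * (α - 1)) =
      Real.exp (Real.log (1 / α) + Real.log (1 - 1 / α) * (α - 1)) := by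
    rw [Real.exp_add, Real.exp_log hp]
  rw [e, Real.binEntropy, Real.log_inv, Real.log_inv]
  congr 1
  field_simp
  ring

lemma brute_pow (α : ℝ) (n : ℕ) :
    brute α ^ n = ∑ k ∈ range (n + 1), (n.choose k : ℝ) * weight α ^ k := by
  rw [brute_eq_one_add_weight, add_comm, add_pow]
  exact sum_congr rfl fun k _ => by simp [mul_comm]

lemma weight_pow_eq {α : ℝ} (hα : 1 < α) (k : ℕ) :
    weight α ^ k = (1 / α) ^ k * (1 - 1 / α) ^ ((α - 1) * k) := by
  have hq : 0 ≤ 1 - 1 / α := by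
    have : 1 / α < 1 := by rw [div_lt_one (by linarith)]; exact hα
    linarith
  rw [weight_eq_rpow hα, mul_pow, Real.rpow_mul hq, Real.rpow_natCast]

lemma sum_binomial_eq_one (p : ℝ) (m : ℕ) :
    ∑ k ∈ range (m + 1), (m.choose k : ℝ) * p ^ k * (1 - p) ^ (m - k) = 1 := by
  have h := add_pow p (1 - p) m
  rw [add_sub_cancel, one_pow] at h
  exact (sum_congr rfl fun k _ => by ring).trans h.symm

/-- The left side is at most one term of the binomial distribution with m trials and success
probability 1/α, because m - k ≤ (α - 1)k. -/
lemma choose_mul_weight_pow_le_one {α : ℝ} (hα : 1 ≤ α) {m k : ℕ} (hm : (m : ℝ) ≤ α * k) :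
    (m.choose k : ℝ) * weight α ^ k ≤ 1 := by
  rcases lt_or_ge m k with hk | hk
  · simp [Nat.choose_eq_zero_of_lt hk]
  rcases hα.eq_or_lt with rfl | hα
  · rw [one_mul] at hm
    have : m = k := le_antisymm (by exact_mod_cast hm) hk
    simp [this, weight_one]
  have hp : 0 < 1 / α := by positivity
  have hq : 0 < 1 - 1 / α := by
    have : 1 / α < 1 := by rw [div_lt_one (by linarith)]; exact hα
    linarith
  have h1 : (1 - 1 / α) ^ ((α - 1) * k) ≤ (1 - 1 / α) ^ (m - k) := by
    rw [← Real.rpow_natCast]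
    apply Real.rpow_le_rpow_of_exponent_ge hq (by linarith)
    rw [Nat.cast_sub hk]; linarith
  have h2 := single_le_sum (f := fun k => (m.choose k : ℝ) * (1 / α) ^ k * (1 - 1 / α) ^ (m - k))
    (s := range (m + 1)) (fun i _ => by positivity) (mem_range.2 (Nat.lt_succ_of_le hk))
  rw [sum_binomial_eq_one] at h2
  refine le_trans ?_ h2
  rw [weight_pow_eq hα, ← mul_assoc]
  gcongr

/-- A central term of a binomial distribution is its largest one. -/
lemma binomial_le_mode {p : ℝ} (hp : 0 ≤ p) (hp1 : p < 1) {s k : ℕ}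
    (h1 : (k : ℝ) ≤ (s + 1) * p) (h2 : (s + 1) * p ≤ k + 1) (hks : k ≤ s) {j : ℕ} (hj : j ≤ s) :
    (s.choose j : ℝ) * p ^ j * (1 - p) ^ (s - j) ≤
      (s.choose k : ℝ) * p ^ k * (1 - p) ^ (s - k) := by
  set a : ℕ → ℝ := fun j => (s.choose j : ℝ) * p ^ j * (1 - p) ^ (s - j) with ha
  have hq : 0 < 1 - p := by linarith
  -- The quotient a (j+1) / a j = (s-j)p / ((j+1)(1-p)) is at least 1 exactly when j + 1 ≤ (s+1)p,
  -- so the terms rise up to k and fall afterwards.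
  have ratio : ∀ j < s, a (j + 1) * ((j + 1) * (1 - p)) = a j * ((s - j) * p) := by
    intro j hj
    have e : s - j = (s - (j + 1)) + 1 := by omega
    have c : (s.choose (j + 1) : ℝ) * (j + 1) = s.choose j * (s - j) := by
      have := Nat.choose_succ_right_eq s j
      rw [← Nat.cast_sub hj.le]; exact_mod_cast this
    simp only [ha]
    rw [e, pow_succ, pow_succ]
    linear_combination p ^ j * p * (1 - p) ^ (s - (j + 1)) * (1 - p) * c
  have hnn : ∀ j, 0 ≤ a j := fun j => by simp only [ha]; positivity
  have up : ∀ j, j < k → a j ≤ a (j + 1) := by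
    intro j hj
    have hjk : (j : ℝ) + 1 ≤ k := by exact_mod_cast hj
    have : a j * ((j + 1) * (1 - p)) ≤ a (j + 1) * ((j + 1) * (1 - p)) := by
      rw [ratio j (by omega)]
      exact mul_le_mul_of_nonneg_left (by nlinarith) (hnn j)
    exact le_of_mul_le_mul_right this (by positivity)
  have down : ∀ j, k ≤ j → j < s → a (j + 1) ≤ a j := by
    intro j hj hjs
    have hjk : (k : ℝ) ≤ j := by exact_mod_cast hj
    have : a (j + 1) * ((j + 1) * (1 - p)) ≤ a j * ((j + 1) * (1 - p)) := by
      rw [ratio j hjs]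
      exact mul_le_mul_of_nonneg_left (by nlinarith) (hnn j)
    exact le_of_mul_le_mul_right this (by positivity)
  change a j ≤ a k
  rcases le_total j k with h | h
  · clear hj
    induction h using Nat.decreasingInduction with
    | self => exact le_rfl
    | of_succ i hi ih => exact (up i hi).trans ih
  · induction j, h using Nat.le_induction with
    | base => exact le_rfl
    | succ i hi ih => exact (down i hi (by omega)).trans (ih (by omega))

/-- With s = ⌊αk⌋ trials and probability 1/α, the most likely outcome is k, so its probability is at
least 1/(s+1). The factor 1 - 1/α pays for rounding αk down to s. -/
lemma one_le_choose_mul_weight_pow {α : ℝ} (hα : 1 < α) (k : ℕ) :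
    (1 - 1 / α) ≤ ((⌊α * k⌋₊ : ℝ) + 1) * ((⌊α * k⌋₊.choose k : ℝ) * weight α ^ k) := by
  set s := ⌊α * k⌋₊ with hs
  have h0 : 0 < α := by linarith
  have hp : 0 < 1 / α := by positivity
  have hp1 : 1 / α < 1 := by rw [div_lt_one (by linarith)]; exact hα
  have hq : 0 < 1 - 1 / α := by linarith
  have hle : (s : ℝ) ≤ α * k := Nat.floor_le (by positivity)
  have hlt : α * k < s + 1 := Nat.lt_floor_add_one _
  have hks : k ≤ s := Nat.le_floor (by nlinarith [(Nat.cast_nonneg k : (0 : ℝ) ≤ k)])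
  have key := sum_le_card_nsmul (range (s + 1))
    (fun j => (s.choose j : ℝ) * (1 / α) ^ j * (1 - 1 / α) ^ (s - j))
    ((s.choose k : ℝ) * (1 / α) ^ k * (1 - 1 / α) ^ (s - k)) (by
      intro j hj
      refine binomial_le_mode hp.le hp1 ?_ ?_ hks (by simpa [Nat.lt_succ_iff] using hj)
      · rw [mul_one_div, le_div_iff₀ h0]; linarith
      · rw [mul_one_div, div_le_iff₀ h0]; nlinarith)
  rw [sum_binomial_eq_one, card_range, nsmul_eq_mul, Nat.cast_add_one] at key
  have h1 : (1 - 1 / α) ^ (s - k) * (1 - 1 / α) ≤ (1 - 1 / α) ^ ((α - 1) * k) := by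
    rw [← pow_succ, ← Real.rpow_natCast]
    apply Real.rpow_le_rpow_of_exponent_ge hq (by linarith)
    push_cast [Nat.cast_sub hks]; linarith
  calc (1 - 1 / α) = 1 * (1 - 1 / α) := by ring
    _ ≤ ((s : ℝ) + 1) * ((s.choose k : ℝ) * (1 / α) ^ k * (1 - 1 / α) ^ (s - k)) *
          (1 - 1 / α) := by gcongr
    _ = ((s : ℝ) + 1) * ((s.choose k : ℝ) * ((1 / α) ^ k * ((1 - 1 / α) ^ (s - k) *
          (1 - 1 / α)))) := by ring
    _ ≤ _ := by rw [weight_pow_eq hα]; gcongr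

/-- The quotients `m.choose k / s.choose k`, for `s` the smaller of `⌊α * k⌋` and `m`, add up
to `brute α ^ m`, up to a polynomial factor. -/
lemma exists_sum_choose_div_choose_le {α : ℝ} (hα : 1 ≤ α) :
    ∃ κ : ℕ, ∀ m : ℕ,
      ∑ k ∈ range (m + 1), (m.choose k : ℝ) / ((min ⌊α * k⌋₊ m).choose k : ℝ) ≤
        κ * (m + 1) * brute α ^ m := by
  -- The constant 1/(1 - 1/α) is unavailable at α = 1, where the weight is 1 and κ = 1 works.
  obtain ⟨κ, hκ0, hκ⟩ : ∃ κ : ℝ, 0 ≤ κ ∧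
      ∀ k : ℕ, 1 ≤ κ * ((⌊α * k⌋₊ : ℝ) + 1) * ((⌊α * k⌋₊.choose k : ℝ) * weight α ^ k) := by
    rcases hα.eq_or_lt with rfl | h
    · refine ⟨1, by simp, fun k => ?_⟩
      simp [weight_one]
    · have hq : 0 < 1 - 1 / α := by
        have : 1 / α < 1 := by rw [div_lt_one (by linarith)]; exact h
        linarith
      refine ⟨1 / (1 - 1 / α), by positivity, fun k => ?_⟩
      have := one_le_choose_mul_weight_pow h k
      rw [mul_assoc, one_div_mul_eq_div, le_div_iff₀ hq]
      linarith
  obtain ⟨N, hN⟩ := exists_nat_ge (1 + κ)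
  refine ⟨N, fun m => ?_⟩
  have hb : (1 : ℝ) ≤ brute α ^ m := one_le_pow₀ (one_lt_brute α).le
  calc ∑ k ∈ range (m + 1), (m.choose k : ℝ) / ((min ⌊α * k⌋₊ m).choose k : ℝ)
      -- The summand 1 accounts for the k with ⌊αk⌋ ≥ m, where the quotient is C(m,k)/C(m,k).
      ≤ ∑ k ∈ range (m + 1), (1 + κ * (m + 1) * ((m.choose k : ℝ) * weight α ^ k)) := by
        apply sum_le_sum
        intro k hk
        have hw := weight_pos α
        rcases le_total ⌊α * k⌋₊ m with h | h
        · rw [min_eq_left h]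
          have hk' : k ≤ ⌊α * k⌋₊ :=
            Nat.le_floor (by nlinarith [(Nat.cast_nonneg k : (0 : ℝ) ≤ k)])
          have hc : (0 : ℝ) < (⌊α * k⌋₊.choose k : ℝ) := by exact_mod_cast Nat.choose_pos hk'
          rw [div_le_iff₀ hc]
          have hm : (⌊α * k⌋₊ : ℝ) ≤ m := by exact_mod_cast h
          have h3 : 1 ≤ κ * ((m : ℝ) + 1) * ((⌊α * k⌋₊.choose k : ℝ) * weight α ^ k) :=
            (hκ k).trans (by gcongr)
          have h4 : (0 : ℝ) ≤ m.choose k := by positivity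
          nlinarith [mul_le_mul_of_nonneg_left h3 h4]
        · rw [min_eq_right h]
          have hc : (0 : ℝ) < (m.choose k : ℝ) := by
            exact_mod_cast Nat.choose_pos (by simpa [Nat.lt_succ_iff] using hk)
          rw [div_self hc.ne']
          have : 0 ≤ κ * (m + 1) * ((m.choose k : ℝ) * weight α ^ k) := by positivity
          linarith
    _ = (m + 1) + κ * (m + 1) * brute α ^ m := by
        rw [sum_add_distrib, ← mul_sum, ← brute_pow]; simp
    _ ≤ (1 + κ) * (m + 1) * brute α ^ m := by nlinarith
    _ ≤ _ := by gcongr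

/-! ### The lower bound -/

/-- The sets that are queried, and the set that is returned, when the oracle is `F`. -/
noncomputable def QueryTree.visited {n : ℕ} (F : Set (Finset (Fin n))) :
    QueryTree n → Finset (Finset (Fin n))
  | .output S => {S}
  | .query S pos neg => insert S (open Classical in if S ∈ F then pos.visited F else neg.visited F)

lemma QueryTree.card_visited_le {n : ℕ} (F : Set (Finset (Fin n))) (t : QueryTree n) :
    (t.visited F).card ≤ t.queries F + 1 := by
  induction t with
  | output S => simp [visited]
  | query S pos neg hp hn =>
    rw [visited, queries]
    refine (card_insert_le _ _).trans ?_
    split_ifs <;> omega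

/-- If the oracles `F` and `G` agree on the sets that are visited with the oracle `F`, then the
run with the oracle `G` is the same, so a set in `G` that is returned is visited. Otherwise the
oracles differ on a visited set. -/
lemma QueryTree.run_mem_visited {n : ℕ} (F G : Set (Finset (Fin n))) (t : QueryTree n) :
    (∃ S ∈ t.visited F, ¬ (S ∈ F ↔ S ∈ G)) ∨ t.run G ∈ t.visited F := by
  induction t with
  | output S => right; simp [visited, run]
  | query S pos neg hp hn =>
    by_cases h : S ∈ F ↔ S ∈ G
    · by_cases hF : S ∈ F
      · have hG := h.1 hF
        simp only [visited, run, hF, hG, if_true]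
        rcases hp with ⟨R, hR, h'⟩ | h'
        · exact Or.inl ⟨R, mem_insert_of_mem hR, h'⟩
        · exact Or.inr (mem_insert_of_mem h')
      · have hG : S ∉ G := fun hG => hF (h.2 hG)
        simp only [visited, run, hF, hG, if_false]
        rcases hn with ⟨R, hR, h'⟩ | h'
        · exact Or.inl ⟨R, mem_insert_of_mem hR, h'⟩
        · exact Or.inr (mem_insert_of_mem h')
    · exact Or.inl ⟨S, by simp [visited], h⟩

/-- The sets of size more than `s`, and the supersets of `T`. -/
def plantedFamily {n : ℕ} (s : ℕ) (T : Finset (Fin n)) : Set (Finset (Fin n)) :=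
  {S | s < S.card ∨ T ⊆ S}

/-- The sets of size more than `s`. -/
def largeFamily (n s : ℕ) : Set (Finset (Fin n)) := {S | s < S.card}

lemma monotoneFamily_plantedFamily {n : ℕ} (s : ℕ) (T : Finset (Fin n)) :
    MonotoneFamily (plantedFamily s T) :=
  ⟨Or.inr (subset_univ _), fun _ _ h hS =>
    hS.imp (fun h' => h'.trans_le (card_le_card h)) fun h' => h'.trans h⟩

lemma monotoneFamily_largeFamily {n s : ℕ} (h : s < n) : MonotoneFamily (largeFamily n s) :=
  ⟨by simpa [largeFamily] using h, fun _ _ h hS => lt_of_lt_of_le hS (card_le_card h)⟩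

/-- The two families differ exactly on the sets of size at most ⌊αk⌋ that contain T. If no such set
distinguishes the runs, the returned set is visited, and it is of this kind itself: T is a member of
size k, so the answer has size at most αk. -/
lemma exists_visited_superset {n k : ℕ} {α : ℝ} {T : Finset (Fin n)}
    (hT : T.card = k) (t : QueryTree n)
    (h : IsApproxSolution α (plantedFamily ⌊α * k⌋₊ T) (t.run (plantedFamily ⌊α * k⌋₊ T))) :
    ∃ S ∈ t.visited (largeFamily n ⌊α * k⌋₊), S.card ≤ ⌊α * k⌋₊ ∧ T ⊆ S := by
  rcases t.run_mem_visited (largeFamily n ⌊α * k⌋₊) (plantedFamily ⌊α * k⌋₊ T) with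
    ⟨S, hS, hne⟩ | hv
  · refine ⟨S, hS, ?_⟩
    simp only [largeFamily, plantedFamily, Set.mem_ofPred_eq] at hne
    rw [← not_lt]; tauto
  · refine ⟨_, hv, ?_⟩
    have hc : (t.run (plantedFamily ⌊α * k⌋₊ T)).card ≤ ⌊α * k⌋₊ :=
      Nat.le_floor ((h.2 T (Or.inr subset_rfl)).trans_eq (by rw [hT]))
    exact ⟨hc, h.1.resolve_left (not_lt.2 hc)⟩

/-- Every solved T is a k-subset of a small visited set. There are at most q + 1 visited sets, the
returned one included, and each has at most C(⌊αk⌋,k) such subsets. -/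
lemma card_solved_le {n k q : ℕ} {α : ℝ} (t : QueryTree n)
    (hq : t.queries (largeFamily n ⌊α * k⌋₊) ≤ q) (P : Finset (Fin n) → Prop) [DecidablePred P]
    (hP : ∀ T, P T →
      IsApproxSolution α (plantedFamily ⌊α * k⌋₊ T) (t.run (plantedFamily ⌊α * k⌋₊ T))) :
    (((univ : Finset (Fin n)).powersetCard k).filter P).card ≤
      (q + 1) * ⌊α * k⌋₊.choose k := by
  set V := (t.visited (largeFamily n ⌊α * k⌋₊)).filter (fun S => S.card ≤ ⌊α * k⌋₊)
  have hsub : ((univ : Finset (Fin n)).powersetCard k).filter P ⊆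
      V.biUnion fun S => S.powersetCard k := by
    intro T hT
    rw [mem_filter, mem_powersetCard] at hT
    obtain ⟨S, hS, hc, hTS⟩ := exists_visited_superset hT.1.2 t (hP T hT.2)
    exact mem_biUnion.2 ⟨S, mem_filter.2 ⟨hS, hc⟩, mem_powersetCard.2 ⟨hTS, hT.1.2⟩⟩
  refine (card_le_card hsub).trans ((card_biUnion_le_card_mul _ _ (⌊α * k⌋₊.choose k) ?_).trans ?_)
  · intro S hS
    rw [card_powersetCard]
    exact Nat.choose_le_choose _ (mem_filter.1 hS).2
  · gcongr
    exact (card_filter_le _ _).trans ((t.card_visited_le _).trans (by omega))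

/-- The averaging argument of Yao's principle: exchanging the two sums turns a bound for each
deterministic strategy into a bound for the sum of the success probabilities. -/
lemma sum_toOuterMeasure_le {ι β : Type*} (p : PMF β) (s : Finset ι) (A : ι → Set β) (N : ℕ)
    (h : ∀ b ∈ p.support, (open Classical in s.filter (fun i => b ∈ A i)).card ≤ N) :
    ∑ i ∈ s, p.toOuterMeasure (A i) ≤ N := by
  classical
  calc ∑ i ∈ s, p.toOuterMeasure (A i) = ∑' b, ∑ i ∈ s, (A i).indicator p b := by
        simp_rw [PMF.toOuterMeasure_apply]
        rw [Summable.tsum_finsetSum fun i _ => ENNReal.summable]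
    _ ≤ ∑' b, N * p b := by
        refine ENNReal.tsum_le_tsum fun b => ?_
        by_cases hb : b ∈ p.support
        · have : ∑ i ∈ s, (A i).indicator p b = ((s.filter (fun i => b ∈ A i)).card : ENNReal) * p b := by
            simp_rw [Set.indicator_apply]
            rw [← sum_filter, sum_const, nsmul_eq_mul]
          rw [this]
          gcongr
          exact_mod_cast (by convert h b hb)
        · have : p b = 0 := by simpa [PMF.mem_support_iff] using hb
          simp [Set.indicator_apply, this]
    _ = N := by rw [ENNReal.tsum_mul_left, p.tsum_coe, mul_one]

/-- The condition αk < n makes the unplanted family contain the whole universe; being monotone, it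
is subject to the query bound. -/
lemma choose_le_of_isRandomizedApprox {α : ℝ} (hα : 0 ≤ α) {A : RandomizedAlgorithm} {q : ℕ → ℕ}
    {γ : ENNReal} (hγ : ∀ (n : ℕ) (F : Set (Finset (Fin n))), MonotoneFamily F →
      γ ≤ (A n).toOuterMeasure {t | IsApproxSolution α F (t.run F)})
    (hq : UsesAtMostQueries A q) {n k : ℕ} (hk : α * k < n) :
    γ * n.choose k ≤ ((q n + 1) * ⌊α * k⌋₊.choose k : ℕ) := by
  have hlt : ⌊α * k⌋₊ < n := (Nat.floor_lt (by positivity)).2 hk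
  refine le_trans ?_ (sum_toOuterMeasure_le (A n) ((univ : Finset (Fin n)).powersetCard k)
    (fun T => {t | IsApproxSolution α (plantedFamily ⌊α * k⌋₊ T)
      (t.run (plantedFamily ⌊α * k⌋₊ T))}) _ ?_)
  · refine le_trans ?_ (card_nsmul_le_sum _ _ γ fun T _ => hγ n _ (monotoneFamily_plantedFamily _ T))
    simp [mul_comm]
  · intro t ht
    classical
    exact card_solved_le t (hq n _ (monotoneFamily_largeFamily hlt) t ht) _ fun _ h => h

lemma brute_pow_le_of_isRandomizedApprox {α : ℝ} (hα : 1 ≤ α) {A : RandomizedAlgorithm}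
    {q : ℕ → ℕ} (hA : IsRandomizedApprox α A) (hq : UsesAtMostQueries A q) :
    ∃ C : ℝ, ∀ n : ℕ, brute α ^ n ≤ C * (n + 1) * (q n + 1) := by
  obtain ⟨γ, hγ0, hγ⟩ := hA
  -- Truncating at 1 makes the constant finite and gives δ ≤ 1, so that the terms with αk ≥ n, which
  -- are at most 1, also obey the bound (q+1)/δ.
  have hγ1 : min γ 1 ≠ ⊤ := (min_le_right γ 1).trans_lt ENNReal.one_lt_top |>.ne
  have hγ' : ∀ (n : ℕ) (F : Set (Finset (Fin n))), MonotoneFamily F →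
      min γ 1 ≤ (A n).toOuterMeasure {t | IsApproxSolution α F (t.run F)} :=
    fun n F hF => (min_le_left _ _).trans (hγ n F hF)
  set δ := (min γ 1).toReal with hδ
  have hδ0 : 0 < δ := ENNReal.toReal_pos (lt_min hγ0 one_pos).ne' hγ1
  have hδ1 : δ ≤ 1 := by
    rw [hδ, ← ENNReal.toReal_one]
    exact ENNReal.toReal_mono ENNReal.one_ne_top (min_le_right _ _)
  refine ⟨1 / δ, fun n => ?_⟩
  have hterm : ∀ k ∈ range (n + 1), (n.choose k : ℝ) * weight α ^ k ≤ (q n + 1) / δ := by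
    intro k _
    have hw := weight_pos α
    rcases le_or_gt (n : ℝ) (α * k) with h | h
    · refine (choose_mul_weight_pow_le_one hα h).trans ?_
      rw [le_div_iff₀ hδ0]
      have : (0 : ℝ) ≤ q n := by positivity
      linarith
    · have h1 := choose_le_of_isRandomizedApprox (by linarith) hγ' hq h
      have h2 : δ * n.choose k ≤ (q n + 1) * ⌊α * k⌋₊.choose k := by
        have := ENNReal.toReal_mono (ENNReal.natCast_ne_top _) h1
        rw [ENNReal.toReal_mul, ENNReal.toReal_natCast, ENNReal.toReal_natCast] at this
        exact_mod_cast this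
      have h3 := choose_mul_weight_pow_le_one hα (m := ⌊α * k⌋₊) (k := k)
        (Nat.floor_le (by positivity))
      rw [le_div_iff₀ hδ0]
      calc (n.choose k : ℝ) * weight α ^ k * δ = δ * n.choose k * weight α ^ k := by ring
        _ ≤ (q n + 1) * ⌊α * k⌋₊.choose k * weight α ^ k := by gcongr
        _ = (q n + 1) * (⌊α * k⌋₊.choose k * weight α ^ k) := by ring
        _ ≤ (q n + 1) * 1 := by gcongr
        _ = q n + 1 := mul_one _
  rw [brute_pow]
  refine (sum_le_card_nsmul _ _ _ hterm).trans (le_of_eq ?_)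
  rw [card_range, nsmul_eq_mul]
  push_cast
  ring

lemma not_oStar_of_isRandomizedApprox {α : ℝ} (hα : 1 ≤ α) {c : ℝ} (hc0 : 0 ≤ c)
    (hc : c < brute α) {A : RandomizedAlgorithm} {q : ℕ → ℕ} (hA : IsRandomizedApprox α A)
    (hq : UsesAtMostQueries A q) : ¬ OStar q c := by
  rintro ⟨d, hO⟩
  obtain ⟨C, hC⟩ := brute_pow_le_of_isRandomizedApprox hα hA hq
  -- For c < 1 the summand 1 in q + 1 would not be absorbed by c^n; enlarging c to b keeps it below
  -- `brute α`.
  set b := max c 1 with hb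
  have hb1 : 1 ≤ b := le_max_right _ _
  have hbb : b < brute α := max_lt hc (one_lt_brute α)
  have hB : 0 < brute α := by linarith [one_lt_brute α]
  have e1 : (fun n : ℕ => (n : ℝ) ^ d * c ^ n) =O[Filter.atTop]
      (fun n : ℕ => (n : ℝ) ^ d * b ^ n) := by
    refine Asymptotics.isBigO_of_le _ fun n => ?_
    rw [Real.norm_of_nonneg (by positivity), Real.norm_of_nonneg (by positivity)]
    gcongr
    exact le_max_left _ _
  have e2 : (fun _ : ℕ => (1 : ℝ)) =O[Filter.atTop] (fun n : ℕ => (n : ℝ) ^ d * b ^ n) := by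
    refine Asymptotics.IsBigO.of_bound 1 ?_
    filter_upwards [Filter.eventually_ge_atTop 1] with n hn
    have hn' : (1 : ℝ) ≤ n := by exact_mod_cast hn
    rw [Real.norm_of_nonneg (by positivity), Real.norm_of_nonneg (by positivity), one_mul]
    exact one_le_mul_of_one_le_of_one_le (one_le_pow₀ hn') (one_le_pow₀ hb1)
  have e3 : (fun n : ℕ => C * ((n : ℝ) + 1)) =O[Filter.atTop] (fun n : ℕ => (n : ℝ)) := by
    refine Asymptotics.IsBigO.const_mul_left ?_ C
    refine Asymptotics.IsBigO.of_bound 2 ?_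
    filter_upwards [Filter.eventually_ge_atTop 1] with n hn
    have hn' : (1 : ℝ) ≤ n := by exact_mod_cast hn
    rw [Real.norm_of_nonneg (by positivity), Real.norm_of_nonneg (by positivity)]
    linarith
  have e4 : (fun n : ℕ => brute α ^ n) =O[Filter.atTop]
      (fun n : ℕ => (n : ℝ) * ((n : ℝ) ^ d * b ^ n)) := by
    refine Asymptotics.IsBigO.trans ?_ (e3.mul ((hO.trans e1).add e2))
    refine Asymptotics.isBigO_of_le _ fun n => ?_
    rw [Real.norm_of_nonneg (by positivity)]
    exact (hC n).trans (le_abs_self _)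
  have e5 : (fun n : ℕ => (n : ℝ) * ((n : ℝ) ^ d * b ^ n)) =o[Filter.atTop]
      (fun n : ℕ => brute α ^ n) := by
    have := isLittleO_pow_const_mul_const_pow_const_pow_of_norm_lt (d + 1) (r₁ := b)
      (r₂ := brute α) (by rwa [Real.norm_of_nonneg (by linarith)])
    refine this.congr_left fun n => ?_
    ring
  have e6 := e4.trans_isLittleO e5
  have := (Asymptotics.isLittleO_irrefl' (l := Filter.atTop) (f' := fun n : ℕ => brute α ^ n)
    (Filter.Frequently.of_forall fun n => by
      rw [Real.norm_of_nonneg (by positivity)]; positivity))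
  exact this e6

/-! ### Numbers as sets of bit positions -/

/-- The set of positions of ones in the binary representation of `x`. -/
def bits (x : ℕ) : Finset ℕ := x.bitIndices.toFinset

@[simp] lemma mem_bits {i x : ℕ} : i ∈ bits x ↔ x.testBit i = true := by simp [bits]

lemma exists_bits_eq (s : Finset ℕ) : ∃ x, bits x = s := Finset.equivBitIndices.surjective s

lemma bits_subset_range_iff {x m : ℕ} : bits x ⊆ range m ↔ x < 2 ^ m := by
  constructor
  · intro h
    refine Nat.lt_pow_two_of_testBit x fun i hi => ?_
    by_contra hc
    have := h (mem_bits.2 (by simpa using hc))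
    rw [mem_range] at this
    omega
  · intro h i hi
    rw [mem_bits] at hi
    rw [mem_range]
    by_contra hc
    rw [Nat.testBit_eq_false_of_lt (h.trans_le (Nat.pow_le_pow_right two_pos (not_lt.1 hc)))] at hi
    simp at hi

lemma card_bits_le {x m : ℕ} (h : x < 2 ^ m) : (bits x).card ≤ m := by
  simpa using card_le_card (bits_subset_range_iff.2 h)

lemma bits_eq_filter {x m : ℕ} (h : x < 2 ^ m) :
    bits x = (range m).filter (fun i => x.testBit i = true) := by
  ext i
  simp only [mem_filter, mem_range, mem_bits]
  refine ⟨fun hi => ⟨?_, hi⟩, fun hi => hi.2⟩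
  exact mem_range.1 (bits_subset_range_iff.2 h (mem_bits.2 hi))

lemma bits_two_pow_mul_add {m a b : ℕ} (hb : b < 2 ^ m) :
    bits (2 ^ m * a + b) = bits b ∪ (bits a).map (addRightEmbedding m) := by
  ext i
  rw [mem_bits, Nat.testBit_two_pow_mul_add a hb, mem_union, mem_map]
  simp only [mem_bits, addRightEmbedding_apply]
  split_ifs with h
  · refine ⟨Or.inl, ?_⟩
    rintro (h' | ⟨j, -, rfl⟩)
    · exact h'
    · omega
  · refine ⟨fun h' => Or.inr ⟨i - m, h', by omega⟩, ?_⟩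
    rintro (h' | ⟨j, hj, rfl⟩)
    · exact absurd (mem_range.1 (bits_subset_range_iff.2 hb (mem_bits.2 h'))) h
    · simpa using hj

lemma card_bits_two_pow_mul_add {m a b : ℕ} (hb : b < 2 ^ m) :
    (bits (2 ^ m * a + b)).card = (bits a).card + (bits b).card := by
  rw [bits_two_pow_mul_add hb, card_union_of_disjoint, card_map, add_comm]
  rw [disjoint_left]
  intro i hi hi'
  obtain ⟨j, -, rfl⟩ := mem_map.1 hi'
  have := mem_range.1 (bits_subset_range_iff.2 hb hi)
  simp at this

/-- The set `S` covers `T`: it contains `T`, and it is at most `α` times as large. -/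
def Covers (α : ℝ) (S T : ℕ) : Prop :=
  bits T ⊆ bits S ∧ ((bits S).card : ℝ) ≤ α * (bits T).card

lemma Covers.refl {α : ℝ} (hα : 1 ≤ α) (T : ℕ) : Covers α T T :=
  ⟨subset_rfl, le_mul_of_one_le_left (Nat.cast_nonneg _) hα⟩

/-- Cardinalities add over disjoint blocks, so the ratio α is preserved when covers of separate
blocks are joined. -/
lemma Covers.two_pow_mul_add {α : ℝ} {m S T S' T' : ℕ} (hS : S < 2 ^ m) (hT : T < 2 ^ m)
    (h : Covers α S T) (h' : Covers α S' T') :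
    Covers α (2 ^ m * S' + S) (2 ^ m * T' + T) := by
  constructor
  · rw [bits_two_pow_mul_add hS, bits_two_pow_mul_add hT]
    exact union_subset_union h.1 (map_subset_map.2 h'.1)
  · rw [card_bits_two_pow_mul_add hS, card_bits_two_pow_mul_add hT]
    push_cast
    linarith [h.2, h'.2]

/-! ### Greedy coverings -/

/-- A bound for the cost of a fractional covering of the subsets of `[m]`. -/
noncomputable def coverWeight (α : ℝ) (m : ℕ) : ℝ :=
  ∑ k ∈ range (m + 1), (m.choose k : ℝ) / ((min ⌊α * k⌋₊ m).choose k : ℝ)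

lemma one_le_coverWeight (α : ℝ) (m : ℕ) : 1 ≤ coverWeight α m := by
  have := single_le_sum (f := fun k => (m.choose k : ℝ) / ((min ⌊α * k⌋₊ m).choose k : ℝ))
    (s := range (m + 1)) (fun i _ => by positivity) (mem_range.2 (Nat.succ_pos m))
  simpa [coverWeight] using this

lemma choose_le_card_supersets {m s : ℕ} {A : Finset ℕ} (hA : A ⊆ range m) (hs : A.card ≤ s) :
    (m - A.card).choose (s - A.card) ≤
      (((range m).powersetCard s).filter (fun B => A ⊆ B)).card := by
  have h := card_powersetCard (s - A.card) (range m \ A)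
  rw [card_sdiff_of_subset hA, card_range] at h
  rw [← h]
  refine card_le_card_of_injOn (fun B => A ∪ B) ?_ ?_
  · intro B hB
    have hB' := mem_powersetCard.1 (mem_coe.1 hB)
    have hd : Disjoint A B := (disjoint_sdiff (s := A) (t := range m)).mono_right hB'.1
    simp only [coe_filter, mem_powersetCard, Set.mem_ofPred_eq]
    refine ⟨⟨union_subset hA (hB'.1.trans sdiff_subset), ?_⟩, subset_union_left⟩
    rw [card_union_of_disjoint hd, hB'.2]
    omega
  · intro B hB C hC hBC
    have hB' := mem_powersetCard.1 (mem_coe.1 hB)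
    have hC' := mem_powersetCard.1 (mem_coe.1 hC)
    have hdB : Disjoint A B := (disjoint_sdiff (s := A) (t := range m)).mono_right hB'.1
    have hdC : Disjoint A C := (disjoint_sdiff (s := A) (t := range m)).mono_right hC'.1
    have := congrArg (· \ A) hBC
    simpa [union_sdiff_distrib, hdB.symm.sdiff_eq_left, hdC.symm.sdiff_eq_left] using this

open Classical in
/-- If no set covers more than `N` members of `U`, then `U` has at most
`N * coverWeight α m` members. -/
lemma card_le_mul_coverWeight {α : ℝ} (hα : 1 ≤ α) {m N : ℕ} {U : Finset ℕ}
    (hU : U ⊆ range (2 ^ m))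
    (hN : ∀ S < 2 ^ m, (U.filter (fun T => Covers α S T)).card ≤ N) :
    (U.card : ℝ) ≤ N * coverWeight α m := by
  have hlev : ∀ k ∈ range (m + 1), ((U.filter (fun T => (bits T).card = k)).card : ℝ) ≤
      N * ((m.choose k : ℝ) / ((min ⌊α * k⌋₊ m).choose k : ℝ)) := by
    intro k hk
    have hkm : k ≤ m := by simpa [Nat.lt_succ_iff] using hk
    set s := min ⌊α * k⌋₊ m with hs
    have hks : k ≤ s :=
      le_min (Nat.le_floor (by nlinarith [(Nat.cast_nonneg k : (0 : ℝ) ≤ k)])) hkm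
    have hsm : s ≤ m := min_le_right _ _
    have hsα : (s : ℝ) ≤ α * k :=
      (Nat.cast_le.2 (min_le_left _ _)).trans (Nat.floor_le (by positivity))
    -- Double counting of the pairs T ⊆ B with T in U of size k and B of size s. As s ≤ αk, each
    -- such B covers the T below it, so it has at most N of them; each T has at least C(m-k,s-k)
    -- supersets.
    have hdc := card_mul_le_card_mul (s := U.filter (fun T => (bits T).card = k))
      (t := (range m).powersetCard s) (fun T B => bits T ⊆ B)
      (m := (m - k).choose (s - k)) (n := N) (by
        intro T hT
        rw [mem_filter] at hT
        have hT' := bits_subset_range_iff.2 (mem_range.1 (hU hT.1))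
        have := choose_le_card_supersets hT' (hT.2.trans_le hks)
        rw [hT.2] at this
        exact this) (by
        intro B hB
        rw [mem_powersetCard] at hB
        obtain ⟨S, rfl⟩ := exists_bits_eq B
        refine (card_le_card ?_).trans (hN S (bits_subset_range_iff.1 hB.1))
        intro T hT
        simp only [bipartiteBelow, mem_filter] at hT ⊢
        refine ⟨hT.1.1, hT.2, ?_⟩
        rw [hB.2, hT.1.2]
        exact hsα)
    rw [card_powersetCard, card_range] at hdc
    have hch : m.choose s * s.choose k = m.choose k * (m - k).choose (s - k) :=
        Nat.choose_mul hks
    have hp1 : 0 < m.choose s := Nat.choose_pos hsm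
    have hp2 : (0 : ℝ) < s.choose k := by exact_mod_cast Nat.choose_pos hks
    rw [← mul_div_assoc, le_div_iff₀ hp2]
    have : (U.filter (fun T => (bits T).card = k)).card * s.choose k ≤ N * m.choose k := by
      refine Nat.le_of_mul_le_mul_left ?_ hp1
      calc m.choose s * ((U.filter (fun T => (bits T).card = k)).card * s.choose k)
          = (U.filter (fun T => (bits T).card = k)).card * (m.choose s * s.choose k) := by ring
        _ = (U.filter (fun T => (bits T).card = k)).card * (m - k).choose (s - k) *
              m.choose k := by rw [hch]; ring
        _ ≤ m.choose s * N * m.choose k := Nat.mul_le_mul_right _ hdc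
        _ = _ := by ring
    exact_mod_cast this
  have hsum : U.card = ∑ k ∈ range (m + 1), (U.filter (fun T => (bits T).card = k)).card := by
    refine card_eq_sum_card_fiberwise fun T hT => ?_
    simp only [coe_range, Set.mem_Iio]
    exact Nat.lt_succ_of_le (card_bits_le (mem_range.1 (hU hT)))
  rw [hsum, coverWeight, mul_sum]
  push_cast
  exact sum_le_sum hlev

open Classical in
/-- The numbers below `M` that none of `G 0, …, G (g - 1)` covers. -/
noncomputable def uncovered (α : ℝ) (M : ℕ) (G : ℕ → ℕ) (g : ℕ) : Finset ℕ :=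
  (range M).filter (fun T => ∀ i < g, ¬ Covers α (G i) T)

lemma mem_uncovered {α : ℝ} {M g T : ℕ} {G : ℕ → ℕ} :
    T ∈ uncovered α M G g ↔ T < M ∧ ∀ i < g, ¬ Covers α (G i) T := by
  simp [uncovered]

open Classical in
/-- The number of uncovered numbers that `S` covers. -/
noncomputable def gain (α : ℝ) (M : ℕ) (G : ℕ → ℕ) (g S : ℕ) : ℕ :=
  ((uncovered α M G g).filter (fun T => Covers α S T)).card

/-- The state of the greedy covering algorithm, when it has `j` rounds left and has chosen
`G 0, …, G (g - 1)`. -/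
structure IsGreedy (α : ℝ) (m j g : ℕ) (G : ℕ → ℕ) : Prop where
  length_add_le : g + j ≤ 2 ^ m
  lt : ∀ i < g, G i < 2 ^ m
  -- Each round covers something new unless nothing is left, so 2^m rounds suffice to finish.
  card_le : (uncovered α (2 ^ m) G g).card ≤ j
  -- This decay is what keeps the list much shorter than the number of rounds.
  card_le_geom : ((uncovered α (2 ^ m) G g).card : ℝ) ≤ 2 ^ m * (1 - 1 / coverWeight α m) ^ g
  length_le : (g : ℝ) ≤ coverWeight α m * m + 1

lemma isGreedy_zero (α : ℝ) (m : ℕ) (G : ℕ → ℕ) : IsGreedy α m (2 ^ m) 0 G := by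
  have h : (uncovered α (2 ^ m) G 0).card ≤ 2 ^ m := by
    simpa using card_le_card (fun T hT => mem_range.2 (mem_uncovered.1 hT).1 :
      uncovered α (2 ^ m) G 0 ⊆ range (2 ^ m))
  have := one_le_coverWeight α m
  refine ⟨by simp, by simp, h, ?_, ?_⟩
  · rw [pow_zero, mul_one]; exact_mod_cast h
  · rw [Nat.cast_zero]; positivity

lemma uncovered_congr {α : ℝ} {M g : ℕ} {G G' : ℕ → ℕ} (h : ∀ i < g, G' i = G i) :
    uncovered α M G' g = uncovered α M G g := by
  ext T
  simp only [uncovered, mem_filter]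
  exact and_congr_right fun _ => forall₂_congr fun i hi => by rw [h i hi]

lemma IsGreedy.congr {α : ℝ} {m j g : ℕ} {G G' : ℕ → ℕ} (h : IsGreedy α m j g G)
    (hG : ∀ i < g, G' i = G i) : IsGreedy α m j g G' := by
  refine ⟨h.length_add_le, fun i hi => (hG i hi).trans_lt (h.lt i hi), ?_, ?_, h.length_le⟩
  · rw [uncovered_congr hG]; exact h.card_le
  · rw [uncovered_congr hG]; exact h.card_le_geom

/-- Since α ≥ 1, an uncovered number would cover itself and have positive gain. -/
lemma IsGreedy.step_of_gain_eq_zero {α : ℝ} (hα : 1 ≤ α) {m j g : ℕ} {G : ℕ → ℕ}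
    (h : IsGreedy α m (j + 1) g G) (h0 : ∀ S < 2 ^ m, gain α (2 ^ m) G g S = 0) :
    IsGreedy α m j g G := by
  have hU : uncovered α (2 ^ m) G g = ∅ := by
    rw [eq_empty_iff_forall_notMem]
    intro T hT
    have hT' : T < 2 ^ m := (mem_uncovered.1 hT).1
    have := h0 T hT'
    rw [gain, card_eq_zero] at this
    classical exact notMem_empty T (this ▸ mem_filter.2 ⟨hT, Covers.refl hα T⟩)
  have := h.length_add_le
  exact ⟨by omega, h.lt, by simp [hU], h.card_le_geom, h.length_le⟩

/-- The maximum gain is at least |U|/W by `card_le_mul_coverWeight`, so the uncovered set U shrinks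
by the factor 1 - 1/W. As U was nonempty, 1 ≤ 2^m (1-1/W)^g ≤ exp(m - g/W), hence g ≤ Wm; the new
set accounts for the + 1 in the length bound. -/
lemma IsGreedy.step {α : ℝ} (hα : 1 ≤ α) {m j g S : ℕ} {G G' : ℕ → ℕ}
    (h : IsGreedy α m (j + 1) g G) (hS : S < 2 ^ m) (hpos : gain α (2 ^ m) G g S ≠ 0)
    (hmax : ∀ R < 2 ^ m, gain α (2 ^ m) G g R ≤ gain α (2 ^ m) G g S)
    (hG : ∀ i < g, G' i = G i) (hg : G' g = S) :
    IsGreedy α m j (g + 1) G' := by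
  classical
  set W := coverWeight α m with hW
  have hW1 : 1 ≤ W := one_le_coverWeight α m
  set U := uncovered α (2 ^ m) G g with hU
  have hU' : uncovered α (2 ^ m) G' (g + 1) = U.filter (fun T => ¬ Covers α S T) := by
    ext T
    simp only [hU, uncovered, mem_filter, Nat.forall_lt_succ_right, hg, and_assoc]
    refine and_congr_right fun _ => and_congr_left fun _ => forall₂_congr fun i hi => ?_
    rw [hG i hi]
  have hsplit : gain α (2 ^ m) G g S + (uncovered α (2 ^ m) G' (g + 1)).card = U.card := by
    rw [hU', gain]; exact card_filter_add_card_filter_not _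
  have hUW : (U.card : ℝ) ≤ gain α (2 ^ m) G g S * W :=
    card_le_mul_coverWeight hα (filter_subset _ _) fun R hR => by
      have := hmax R hR
      rw [gain] at this
      convert this
  have hfac : 0 ≤ 1 - 1 / W := by
    have : 1 / W ≤ 1 := by rw [div_le_one (by linarith)]; exact hW1
    linarith
  have hle := h.length_add_le
  have hc : U.card ≤ j + 1 := h.card_le
  refine ⟨by omega, ?_, by omega, ?_, ?_⟩
  · intro i hi
    rcases Nat.lt_succ_iff_lt_or_eq.1 hi with hi | rfl
    · rw [hG i hi]; exact h.lt i hi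
    · rw [hg]; exact hS
  · have e : ((uncovered α (2 ^ m) G' (g + 1)).card : ℝ) =
        U.card - gain α (2 ^ m) G g S := by
      rw [← hsplit]; push_cast; ring
    have : (U.card : ℝ) / W ≤ gain α (2 ^ m) G g S := by
      rw [div_le_iff₀ (by linarith)]; exact hUW
    calc ((uncovered α (2 ^ m) G' (g + 1)).card : ℝ) ≤ U.card * (1 - 1 / W) := by
          rw [e, mul_sub, mul_one, mul_one_div]; linarith
      _ ≤ 2 ^ m * (1 - 1 / W) ^ g * (1 - 1 / W) := by gcongr; exact h.card_le_geom
      _ = _ := by rw [pow_succ]; ring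
  · have h1 : (1 : ℝ) ≤ 2 ^ m * (1 - 1 / W) ^ g := by
      refine le_trans ?_ h.card_le_geom
      have : 1 ≤ U.card := by omega
      exact_mod_cast this
    have h2 : (1 - 1 / W) ^ g ≤ Real.exp (-(g / W)) := by
      calc (1 - 1 / W) ^ g ≤ Real.exp (-(1 / W)) ^ g := by
            gcongr
            linarith [Real.add_one_le_exp (-(1 / W))]
        _ = _ := by rw [← Real.exp_nat_mul]; congr 1; ring
    have h3 : (2 : ℝ) ^ m ≤ Real.exp m := by
      rw [← mul_one (m : ℝ), Real.exp_nat_mul]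
      gcongr
      linarith [Real.add_one_le_exp (1 : ℝ)]
    have h4 : (1 : ℝ) ≤ Real.exp (m - g / W) := by
      calc (1 : ℝ) ≤ 2 ^ m * (1 - 1 / W) ^ g := h1
        _ ≤ Real.exp m * Real.exp (-(g / W)) := by gcongr
        _ = _ := by rw [← Real.exp_add]; congr 1
    have h5 : (g : ℝ) / W ≤ m := by
      have := Real.one_le_exp_iff.1 h4
      linarith
    rw [div_le_iff₀ (by linarith)] at h5
    push_cast
    linarith

lemma IsGreedy.exists_covers {α : ℝ} {m g : ℕ} {G : ℕ → ℕ} (h : IsGreedy α m 0 g G) {T : ℕ}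
    (hT : T < 2 ^ m) : ∃ i < g, Covers α (G i) T := by
  by_contra! hc
  have hU := card_eq_zero.1 (Nat.le_zero.1 h.card_le)
  exact notMem_empty T (hU ▸ mem_uncovered.2 ⟨hT, hc⟩)

lemma IsGreedy.length_pos {α : ℝ} {m g : ℕ} {G : ℕ → ℕ} (h : IsGreedy α m 0 g G) : 0 < g := by
  obtain ⟨i, hi, -⟩ := h.exists_covers (Nat.two_pow_pos m)
  omega

/-! ### Products of coverings -/

/-- The number with `l` digits to base `M` that are read off from the list `G 0, …, G (g - 1)`
at the positions given by the digits of `J` to base `g`. -/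
def word (M : ℕ) (G : ℕ → ℕ) (g : ℕ) : ℕ → ℕ → ℕ
  | 0, _ => 0
  | l + 1, J => G (J % g) + M * word M G g l (J / g)

lemma word_lt {M g : ℕ} {G : ℕ → ℕ} (hg : 0 < g) (h : ∀ i < g, G i < M) (l J : ℕ) :
    word M G g l J < M ^ l := by
  induction l generalizing J with
  | zero => simp [word]
  | succ l ih =>
    have h1 := h _ (Nat.mod_lt J hg)
    have h2 := Nat.mul_le_mul_left M (ih (J / g))
    rw [word, pow_succ, mul_comm (M ^ l)]
    rw [Nat.mul_succ] at h2
    omega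

/-- Each base-2^m digit of T is covered by some list entry; the indices of these entries are the
base-g digits of J. -/
lemma IsGreedy.exists_word_covers {α : ℝ} {m g : ℕ} {G : ℕ → ℕ} (h : IsGreedy α m 0 g G)
    (l T : ℕ) (hT : T < (2 ^ m) ^ l) : ∃ J < g ^ l, Covers α (word (2 ^ m) G g l J) T := by
  induction l generalizing T with
  | zero =>
    have : T = 0 := by simpa using hT
    exact ⟨0, by simp, by simp [word, this, Covers, bits]⟩
  | succ l ih =>
    have hT' : T / 2 ^ m < (2 ^ m) ^ l := by
      rw [Nat.div_lt_iff_lt_mul (Nat.two_pow_pos m)]; rwa [pow_succ] at hT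
    obtain ⟨J, hJ, hc⟩ := ih _ hT'
    have hm : T % 2 ^ m < 2 ^ m := Nat.mod_lt _ (Nat.two_pow_pos m)
    obtain ⟨i, hi, hc'⟩ := h.exists_covers hm
    refine ⟨g * J + i, ?_, ?_⟩
    · have := Nat.mul_le_mul_left g (Nat.succ_le_of_lt hJ)
      rw [Nat.mul_succ] at this
      rw [pow_succ, mul_comm (g ^ l)]
      omega
    · have e1 : (g * J + i) % g = i := by rw [Nat.mul_add_mod, Nat.mod_eq_of_lt hi]
      have e2 : (g * J + i) / g = J := by
        rw [Nat.mul_add_div (by omega), Nat.div_eq_of_lt hi, add_zero]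
      rw [word, e1, e2, add_comm, ← Nat.div_add_mod T (2 ^ m)]
      exact Covers.two_pow_mul_add (h.lt i hi) hm hc' hc

lemma map_decode (n x : ℕ) :
    (decode n x).map Fin.valEmbedding = (bits x).filter (fun i => i < n) := by
  ext i
  simp only [decode, mem_map, mem_filter, mem_univ, true_and, Fin.valEmbedding_apply, mem_bits]
  exact ⟨fun ⟨j, hj, e⟩ => e ▸ ⟨hj, j.2⟩, fun ⟨h, hi⟩ => ⟨⟨i, hi⟩, h, rfl⟩⟩

lemma card_decode_le (n x : ℕ) : (decode n x).card ≤ (bits x).card := by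
  rw [← card_map Fin.valEmbedding, map_decode]
  exact card_filter_le _ _

/-- A number of minimum weight among the words that encode members of `F` encodes an approximate
minimum solution. -/
lemma IsGreedy.isApproxSolution {α : ℝ} {m g n l x : ℕ} {G : ℕ → ℕ} (h : IsGreedy α m 0 g G)
    (hn : n ≤ m * l) {F : Set (Finset (Fin n))} (hF : MonotoneFamily F) (hx : decode n x ∈ F)
    (hmin : ∀ J < g ^ l, decode n (word (2 ^ m) G g l J) ∈ F →
      (bits x).card ≤ (bits (word (2 ^ m) G g l J)).card) :
    IsApproxSolution α F (decode n x) := by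
  refine ⟨hx, fun T hT => ?_⟩
  obtain ⟨t, ht⟩ := exists_bits_eq (T.map Fin.valEmbedding)
  have htm : t < (2 ^ m) ^ l := by
    rw [← pow_mul, ← bits_subset_range_iff, ht]
    intro i hi
    obtain ⟨j, -, rfl⟩ := mem_map.1 hi
    exact mem_range.2 (j.2.trans_le hn)
  obtain ⟨J, hJ, hc⟩ := h.exists_word_covers l t htm
  have hsub : T ⊆ decode n (word (2 ^ m) G g l J) := by
    rw [← map_subset_map (f := Fin.valEmbedding), map_decode, ← ht]
    intro i hi
    refine mem_filter.2 ⟨hc.1 hi, ?_⟩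
    rw [ht] at hi
    obtain ⟨j, -, rfl⟩ := mem_map.1 hi
    exact j.2
  have h1 := hmin J hJ (hF.2 _ _ hsub hT)
  -- Weights count all m * l bits. Decoding discards the positions from n on, which can only make
  -- the solution smaller.
  calc ((decode n x).card : ℝ) ≤ (bits x).card := by exact_mod_cast card_decode_le n x
    _ ≤ (bits (word (2 ^ m) G g l J)).card := by exact_mod_cast h1
    _ ≤ α * (bits t).card := hc.2
    _ = α * T.card := by rw [ht, card_map]

/-! ### Reasoning about programs -/

/-- Started in memory `m` with all cells below `2 ^ L`, the program `P` halts in a memory that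
satisfies `Q`, keeps all cells below `2 ^ L`, and takes at most `c` times the time of a single
instruction on such numbers. -/
def Ends (α : ℝ) {n : ℕ} (F : Set (Finset (Fin n))) (L : ℕ) (P : Program) (m : Memory) (c : ℕ)
    (Q : Memory → Prop) : Prop :=
  (∀ i, m i < 2 ^ L) → ∃ m' t, Exec α F P m m' t ∧ t ≤ c * (2 * L + 1) ∧ (∀ i, m' i < 2 ^ L) ∧ Q m'

/-- The new number that an instruction produces is below `2 ^ L`, if the numbers in memory are. -/
def Instr.Fits (α : ℝ) (L : ℕ) : Instr → Memory → Prop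
  | .const _ c, _ => c < 2 ^ L
  | .add _ a b, m => m a + m b < 2 ^ L
  | .mul _ a b, m => m a * m b < 2 ^ L
  | .scale _ a, m => ⌊α * (m a : ℝ)⌋₊ < 2 ^ L
  | .query _ _, _ => 1 < 2 ^ L
  -- The remaining instructions never produce a number larger than one already in memory.
  | _, _ => True

/-- The effect of a list of instructions. -/
noncomputable def evalAll (α : ℝ) {n : ℕ} (F : Set (Finset (Fin n))) : List Instr → Memory → Memory
  | [], m => m
  | i :: l, m => evalAll α F l (i.eval α F m)

/-- All instructions of a list fit, when they are executed one after the other. -/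
def FitsAll (α : ℝ) {n : ℕ} (F : Set (Finset (Fin n))) (L : ℕ) : List Instr → Memory → Prop
  | [], _ => True
  | i :: l, m => i.Fits α L m ∧ FitsAll α F L l (i.eval α F m)

/-- The program that executes a list of instructions. -/
def block : List Instr → Program
  | [] => .skip
  | i :: l => .seq (.instr i) (block l)

/-- The program that executes `P` as often as cell `a` says, counting cell `a` down. Cell `1` has
to contain the number one. -/
def countdown (a : ℕ) (P : Program) : Program :=
  .loop a (.seq (.instr (.sub a a 1)) P)

section

variable {α : ℝ} {n : ℕ} {F : Set (Finset (Fin n))} {L : ℕ}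

lemma Ends.mono {P : Program} {m : Memory} {c c' : ℕ} {Q Q' : Memory → Prop}
    (h : Ends α F L P m c Q) (hc : c ≤ c') (hQ : ∀ m', Q m' → Q' m') : Ends α F L P m c' Q' := by
  intro hm
  obtain ⟨m', t, hx, ht, hb, hq⟩ := h hm
  exact ⟨m', t, hx, ht.trans (Nat.mul_le_mul_right _ hc), hb, hQ _ hq⟩

lemma Ends.seq {P P' : Program} {m : Memory} {c c' : ℕ} {Q R : Memory → Prop}
    (h : Ends α F L P m c Q) (h' : ∀ m', Q m' → Ends α F L P' m' c' R) :
    Ends α F L (.seq P P') m (c + c') R := by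
  intro hm
  obtain ⟨m', t, hx, ht, hb, hq⟩ := h hm
  obtain ⟨m'', t', hx', ht', hb', hq'⟩ := h' m' hq hb
  exact ⟨m'', t + t', hx.seq hx', by rw [add_mul]; omega, hb', hq'⟩

lemma Ends.skip {m : Memory} {Q : Memory → Prop} (h : Q m) : Ends α F L .skip m 1 Q :=
  fun hm => ⟨m, 1, .skip m, by omega, hm, h⟩

lemma Instr.eval_lt {i : Instr} {m : Memory} (hm : ∀ j, m j < 2 ^ L) (h : i.Fits α L m) (j : ℕ) :
    i.eval α F m j < 2 ^ L := by
  cases i <;> simp only [Instr.eval, Function.update_apply] <;> split_ifs <;>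
    first
    | exact hm _
    | exact h
    | exact (Nat.sub_le _ _).trans_lt (hm _)
    | exact (Nat.div_le_self _ _).trans_lt (hm _)
    | exact zero_lt_one.trans h

lemma Instr.cost_le {i : Instr} {m : Memory} (hm : ∀ j, m j < 2 ^ L) (h : i.Fits α L m) :
    i.cost α m ≤ 2 * L + 1 := by
  have hs : ∀ j, (m j).size ≤ L := fun j => Nat.size_le.2 (hm j)
  cases i with
  | const d c => have := Nat.size_le.2 h; simp only [Instr.cost]; omega
  | copy d a => have := hs a; simp only [Instr.cost]; omega
  | add d a b => have := hs a; have := hs b; simp only [Instr.cost]; omega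
  | sub d a b => have := hs a; have := hs b; simp only [Instr.cost]; omega
  | mul d a b => have := hs a; have := hs b; simp only [Instr.cost]; omega
  | div d a b => have := hs a; have := hs b; simp only [Instr.cost]; omega
  | scale d a => have := hs a; have := Nat.size_le.2 h; simp only [Instr.cost]; omega
  | load d a => have := hs a; have := hs (m a); simp only [Instr.cost]; omega
  | store a b => have := hs a; have := hs b; simp only [Instr.cost]; omega
  | query d a => have := hs a; simp only [Instr.cost]; omega

lemma Ends.instr {i : Instr} {m : Memory} {Q : Memory → Prop} (hf : i.Fits α L m)
    (h : Q (i.eval α F m)) : Ends α F L (.instr i) m 1 Q :=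
  fun hm => ⟨_, _, .instr i m, by rw [one_mul]; exact Instr.cost_le hm hf,
    Instr.eval_lt hm hf, h⟩

lemma Ends.block {l : List Instr} {m : Memory} {Q : Memory → Prop} (hf : FitsAll α F L l m)
    (h : Q (evalAll α F l m)) : Ends α F L (block l) m (l.length + 1) Q := by
  induction l generalizing m with
  | nil => exact Ends.skip h
  | cons i l ih =>
    exact ((Ends.instr (Q := fun m' => m' = i.eval α F m) hf.1 rfl).seq
      fun m' hm' => hm' ▸ ih hf.2 h).mono (by simp [add_comm]) fun _ => id

lemma Ends.ite {a : ℕ} {P P' : Program} {m : Memory} {c : ℕ} {Q : Memory → Prop}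
    (h1 : m a ≠ 0 → Ends α F L P m c Q) (h2 : m a = 0 → Ends α F L P' m c Q) :
    Ends α F L (.ite a P P') m (c + 1) Q := by
  intro hm
  have hs := Nat.size_le.2 (hm a)
  by_cases ha : m a = 0
  · obtain ⟨m', t, hx, ht, hb, hq⟩ := h2 ha hm
    exact ⟨m', _, .ite_false ha hx, by rw [add_mul]; omega, hb, hq⟩
  · obtain ⟨m', t, hx, ht, hb, hq⟩ := h1 ha hm
    exact ⟨m', _, .ite_true ha hx, by rw [add_mul]; omega, hb, hq⟩

/-- The rule for counting loops: `I j` is the invariant for `j` remaining rounds. -/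
lemma Ends.countdown {a : ℕ} {P : Program} {c : ℕ} (I : ℕ → Memory → Prop)
    (hone : ∀ j m, I j m → m 1 = 1) {k : ℕ} {m : Memory} (hk : m a = k) (hI : I k m)
    -- The counter is decreased before the body runs, so the rounds see k - 1, ..., 0 and the body
    -- can use the counter as an index.
    (hstep : ∀ j m, j < k → m a = j + 1 → I (j + 1) m →
      Ends α F L P (Function.update m a j) c (fun m' => m' a = j ∧ I j m')) :
    Ends α F L (countdown a P) m (k * (c + 2) + 1) (fun m' => m' a = 0 ∧ I 0 m') := by
  induction k generalizing m with
  | zero =>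
    intro hm
    have hs := Nat.size_le.2 (hm a)
    exact ⟨m, _, .loop_done hk, by omega, hm, hk, hI⟩
  | succ k ih =>
    intro hm
    have hs := Nat.size_le.2 (hm a)
    have h1 : Ends α F L (.seq (.instr (.sub a a 1)) P) m (1 + c) (fun m' => m' a = k ∧ I k m') :=
      (Ends.instr (i := .sub a a 1) (Q := fun m' => m' = Function.update m a k) trivial (by
        simp [Instr.eval, hk, hone _ _ hI])).seq
        fun m' hm' => hm' ▸ hstep k m (Nat.lt_succ_self k) hk hI
    obtain ⟨m', t, hx, ht, hb, hka, hI'⟩ := h1 hm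
    obtain ⟨m'', t', hx', ht', hb', hq⟩ :=
      ih hka hI' (fun j m hj => hstep j m (hj.trans (Nat.lt_succ_self k))) hb
    refine ⟨m'', _, .loop_step (by omega) hx hx', ?_, hb', hq⟩
    -- A round costs one unit for the test, one for the subtraction and c for the body; the final
    -- test costs one more.
    have e : ((k + 1) * (c + 2) + 1) * (2 * L + 1) =
      (2 * L + 1) + (1 + c) * (2 * L + 1) + (k * (c + 2) + 1) * (2 * L + 1) := by ring
    rw [e]
    omega

end

/-! ### The program -/

/-- The memories agree on the cells below `b` and on the cells from `40` on, which hold the list of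
chosen sets. -/
def SameOutside (b : ℕ) (m m' : Memory) : Prop := ∀ i, i < b ∨ 40 ≤ i → m' i = m i

lemma SameOutside.refl (b : ℕ) (m : Memory) : SameOutside b m m := fun _ _ => rfl

lemma SameOutside.trans {b : ℕ} {m m' m'' : Memory} (h : SameOutside b m m')
    (h' : SameOutside b m' m'') : SameOutside b m m'' := fun i hi => (h' i hi).trans (h i hi)

lemma SameOutside.mono {b b' : ℕ} {m m' : Memory} (h : SameOutside b' m m') (hb : b ≤ b') :
    SameOutside b m m' := fun i hi => h i (hi.imp (fun h => h.trans_le hb) id)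

/-- The instruction changes only a cell from `b` on and below `40`. -/
def Instr.WritesFrom (b : ℕ) : Instr → Prop
  | .const d _ | .copy d _ | .add d _ _ | .sub d _ _ | .mul d _ _ | .div d _ _ | .scale d _
  | .load d _ | .query d _ => b ≤ d ∧ d < 40
  | .store _ _ => False

lemma SameOutside.eval {α : ℝ} {n : ℕ} {F : Set (Finset (Fin n))} {b : ℕ} {i : Instr}
    (h : i.WritesFrom b) (m : Memory) : SameOutside b m (i.eval α F m) := by
  intro j hj
  cases i <;> simp only [Instr.WritesFrom] at h <;> exact Function.update_of_ne (by omega) _ _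

/-- The frame rule: nested subroutines use scratch cells with higher numbers, so the data of their
callers survive. -/
lemma SameOutside.evalAll {α : ℝ} {n : ℕ} {F : Set (Finset (Fin n))} {b : ℕ} {l : List Instr}
    (h : ∀ i ∈ l, i.WritesFrom b) (m : Memory) : SameOutside b m (evalAll α F l m) := by
  induction l generalizing m with
  | nil => exact .refl b m
  | cons i l ih =>
    rw [List.forall_mem_cons] at h
    exact (SameOutside.eval h.1 m).trans (ih h.2 _)

lemma SameOutside.update_left {b a x : ℕ} {m m' : Memory}
    (h : SameOutside b (Function.update m a x) m') (hb : b ≤ a) (ha : a < 40) :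
    SameOutside b m m' := fun i hi => by
  rw [h i hi, Function.update_of_ne (by omega)]

/-- The number of ones of `x` among the lowest `i` bits. -/
def lowCount (x i : ℕ) : ℕ := ((range i).filter (fun j => x.testBit j = true)).card

/-- The number of positions among the lowest `i` at which `y` has a one and `x` has none. -/
def lowMissing (x y i : ℕ) : ℕ :=
  ((range i).filter (fun j => y.testBit j = true ∧ x.testBit j = false)).card

lemma lowCount_succ (x i : ℕ) : lowCount x (i + 1) = lowCount x i + x / 2 ^ i % 2 := by
  rw [lowCount, range_add_one, filter_insert]
  have h := Nat.mod_two_eq_zero_or_one (x / 2 ^ i)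
  have ht := Nat.testBit_eq_decide_div_mod_eq (x := x) (i := i)
  split_ifs with hb
  · rw [card_insert_of_notMem (by simp), lowCount]
    rw [hb] at ht
    simp at ht
    rw [ht]
  · rw [ht] at hb
    simp at hb
    simp [lowCount, hb]

/-- The truncated difference of two bits is 1 exactly when the first is one and the second is zero,
which lets the machine test inclusion by arithmetic. -/
lemma lowMissing_succ (x y i : ℕ) :
    lowMissing x y (i + 1) = lowMissing x y i + (y / 2 ^ i % 2 - x / 2 ^ i % 2) := by
  rw [lowMissing, range_add_one, filter_insert]
  have hx := Nat.mod_two_eq_zero_or_one (x / 2 ^ i)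
  have hy := Nat.mod_two_eq_zero_or_one (y / 2 ^ i)
  rw [Nat.testBit_eq_decide_div_mod_eq, Nat.testBit_eq_decide_div_mod_eq]
  rcases hx with hx | hx <;> rcases hy with hy | hy <;> simp [hx, hy, lowMissing]

lemma lowCount_le (x i : ℕ) : lowCount x i ≤ i := by
  simpa [lowCount] using card_filter_le (range i) (fun j => x.testBit j = true)

lemma lowMissing_le (x y i : ℕ) : lowMissing x y i ≤ i := by
  simpa [lowMissing] using
    card_filter_le (range i) (fun j => y.testBit j = true ∧ x.testBit j = false)

lemma card_bits_eq_lowCount {x w : ℕ} (h : x < 2 ^ w) : (bits x).card = lowCount x w := by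
  rw [bits_eq_filter h, lowCount]

lemma lowMissing_eq_zero_iff {x y w : ℕ} (hy : y < 2 ^ w) :
    lowMissing x y w = 0 ↔ bits y ⊆ bits x := by
  rw [lowMissing, card_eq_zero, filter_eq_empty_iff]
  constructor
  · intro h i hi
    have := h (bits_subset_range_iff.2 hy hi)
    rw [mem_bits] at hi ⊢
    simpa [hi] using this
  · rintro h i - ⟨h1, h2⟩
    have := h (mem_bits.2 h1)
    rw [mem_bits, h2] at this
    cases this

/-- Counts the lowest bits of cells `20` and `21`, and removes them. -/
def scanBit : Program :=
  block [.div 26 20 2, .div 27 21 2, .mul 28 26 2, .sub 28 20 28, .mul 29 27 2, .sub 29 21 29,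
    .add 23 23 28, .add 24 24 29, .sub 30 29 28, .add 25 25 30, .copy 20 26, .copy 21 27]

/-- Scans the bits of cells `20` and `21`. Then cell `23` contains the number of ones of the former,
and cell `28` is zero iff the former covers the latter. -/
def scan : Program :=
  .seq (block [.copy 22 3, .const 23 0, .const 24 0, .const 25 0])
  (.seq (countdown 22 scanBit)
  -- With truncated subtraction, cell `28` is a sum of two naturals that vanishes iff the size is at
  -- most ⌊α|T|⌋ and no element of T is missing.
  (block [.scale 28 24, .sub 28 23 28, .add 28 28 25]))

/-- Adds one to cell `12` if cell `13` is not covered by the list of chosen sets, but is covered by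
cell `11`. -/
def testElement : Program :=
  -- Cell `14` is a flag, cleared as soon as a listed set covers cell `13`, or finally if cell `11`
  -- does not cover it.
  .seq (block [.const 14 1, .copy 15 5])
  (.seq (countdown 15 (.seq (block [.add 16 15 7, .load 20 16, .copy 21 13])
    (.seq scan (.ite 28 .skip (.instr (.const 14 0))))))
  (.seq (block [.copy 20 11, .copy 21 13])
  (.seq scan (.seq (.ite 28 (.instr (.const 14 0)) .skip) (.instr (.add 12 12 14))))))

/-- Computes the gain of cell `11` in cell `12`. -/
def computeGain : Program :=
  .seq (block [.const 12 0, .copy 13 4]) (countdown 13 testElement)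

/-- Computes a set of maximum gain in cell `10`, and its gain in cell `9`. -/
def findBest : Program :=
  .seq (block [.const 9 0, .const 10 0, .copy 11 4])
  (countdown 11 (.seq computeGain (.seq (.instr (.sub 16 12 9))
    (.ite 16 (block [.copy 9 12, .copy 10 11]) .skip))))

/-- Computes a covering in the cells from `40` on, and its length in cell `5`. -/
def computeCovering : Program :=
  .seq (block [.const 5 0, .copy 8 4])
  (countdown 8 (.seq findBest (.ite 9 (block [.add 16 5 7, .store 16 10, .add 5 5 1]) .skip)))

/-- Computes in cell `12` the word that is given by the digits of cell `8`. -/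
def computeWord : Program :=
  .seq (block [.copy 11 8, .const 12 0, .const 14 1, .copy 13 6])
  (countdown 13 (block [.div 15 11 5, .mul 16 15 5, .sub 16 11 16, .add 16 16 7, .load 16 16,
    .mul 16 16 14, .add 12 12 16, .mul 14 14 4, .copy 11 15]))

/-- Queries the word that is given by the digits of cell `8`, and copies it to cell `9` and its
weight to cell `10` if it is a member of smaller weight. -/
def tryWord : Program :=
  .seq computeWord (.seq (.instr (.query 17 12)) (.ite 17
    (.seq (block [.copy 20 12, .copy 21 12]) (.seq scan (.seq (.instr (.sub 18 10 23))
      (.ite 18 (block [.copy 9 12, .copy 10 23]) .skip)))) .skip))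

/-- Tries all words and leaves the best one in cell `0`. -/
def searchWords : Program :=
  .seq (block [.const 8 1, .const 9 1, .copy 13 6])
  (.seq (countdown 13 (block [.mul 8 8 5, .mul 9 9 4]))
  -- Cell `9` holds 2^(rk) here; subtracting one gives the all-ones number, so the search starts
  -- with the whole universe and its weight rk.
  (.seq (block [.sub 9 9 1, .copy 10 3])
  (.seq (countdown 8 tryWord) (.instr (.copy 0 9)))))

/-- Initializes the constants, for a division of the universe into `r` parts. -/
def initConstants (r : ℕ) : Program :=
  -- The block size is n / r + 1, so that r blocks have room for all n elements.
  .seq (block [.const 1 1, .const 2 2, .const 7 40, .const 6 r, .div 3 0 6, .add 3 3 1,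
    .copy 11 3, .mul 3 3 6, .const 4 1])
  (countdown 11 (block [.mul 4 4 2]))

/-- The algorithm, for a division of the universe into `r` parts. -/
def coveringSearch (r : ℕ) : Program :=
  .seq (initConstants r) (.seq computeCovering searchWords)

/-- The cells with the constants of the program have the right contents. -/
structure HasConstants (r k : ℕ) (m : Memory) : Prop where
  one : m 1 = 1
  two : m 2 = 2
  width : m 3 = r * k
  modulus : m 4 = 2 ^ k
  parts : m 6 = r
  base : m 7 = 40

lemma HasConstants.congr {r k b : ℕ} {m m' : Memory} (h : HasConstants r k m)
    (hs : SameOutside b m m') (hb : 8 ≤ b) : HasConstants r k m' :=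
  ⟨(hs 1 (by omega)).trans h.one, (hs 2 (by omega)).trans h.two, (hs 3 (by omega)).trans h.width,
    (hs 4 (by omega)).trans h.modulus, (hs 6 (by omega)).trans h.parts,
    (hs 7 (by omega)).trans h.base⟩

/-- There is room for all numbers that occur in the computation. -/
structure HasRoom (α : ℝ) (r k L : ℕ) : Prop where
  pos : 0 < r
  const_le : r + 50 < 2 ^ L
  two_mul_le : 2 * 2 ^ (r * k) < 2 ^ L
  address_le : 2 ^ (r * k) + 40 < 2 ^ L
  scale_lt : ∀ i ≤ r * k, ⌊α * (i : ℝ)⌋₊ < 2 ^ L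

/-! ### Correctness and step count of the bit scan -/

section

variable {α : ℝ} {n : ℕ} {F : Set (Finset (Fin n))} {L r k : ℕ}

lemma scanBit_ends {m : Memory} (h2 : m 2 = 2) (h23 : m 23 + 1 < 2 ^ L)
    (h24 : m 24 + 1 < 2 ^ L) (h25 : m 25 + 1 < 2 ^ L) (h20 : m 20 < 2 ^ L) (h21 : m 21 < 2 ^ L) :
    Ends α F L scanBit m 13 (fun m' => m' 20 = m 20 / 2 ∧ m' 21 = m 21 / 2 ∧ m' 22 = m 22 ∧
      m' 23 = m 23 + m 20 % 2 ∧ m' 24 = m 24 + m 21 % 2 ∧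
      m' 25 = m 25 + (m 21 % 2 - m 20 % 2) ∧ SameOutside 20 m m') := by
  have d20 : m 20 - m 20 / 2 * 2 = m 20 % 2 := by omega
  have d21 : m 21 - m 21 / 2 * 2 = m 21 % 2 := by omega
  refine Ends.block ?_ ⟨?_, ?_, ?_, ?_, ?_, ?_, SameOutside.evalAll (by simp [Instr.WritesFrom]) m⟩
  · simp [FitsAll, Instr.Fits, Instr.eval, h2, d20, d21]
    omega
  all_goals simp [evalAll, Instr.eval, h2, d20, d21]

lemma scan_ends (hα : 0 ≤ α) (hr : HasRoom α r k L) {m : Memory} (hc : HasConstants r k m)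
    (hS : m 20 < 2 ^ (r * k)) (hT : m 21 < 2 ^ (r * k)) :
    Ends α F L scan m (15 * (r * k) + 10) (fun m' => m' 23 = (bits (m 20)).card ∧
      (m' 28 = 0 ↔ Covers α (m 20) (m 21)) ∧ SameOutside 20 m m') := by
  have hwidth := hc.width
  have hroom := hr.two_mul_le
  have hscale := hr.scale_lt
  generalize r * k = w at *
  have hw2 : w < 2 ^ w := Nat.lt_two_pow_self
  -- With j rounds left, the lowest w - j bits have been counted and shifted out.
  let I : ℕ → Memory → Prop := fun j m' => j ≤ w ∧ m' 20 = m 20 / 2 ^ (w - j) ∧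
    m' 21 = m 21 / 2 ^ (w - j) ∧ m' 23 = lowCount (m 20) (w - j) ∧
    m' 24 = lowCount (m 21) (w - j) ∧ m' 25 = lowMissing (m 20) (m 21) (w - j) ∧
    SameOutside 20 m m'
  have h1 : Ends α F L (block [.copy 22 3, .const 23 0, .const 24 0, .const 25 0]) m 5
      (fun m' => m' 22 = w ∧ I w m') := by
    refine Ends.block (by simp [FitsAll, Instr.Fits]) ⟨by simp [evalAll, Instr.eval, hwidth],
      le_rfl, ?_, ?_, ?_, ?_, ?_, SameOutside.evalAll (by simp [Instr.WritesFrom]) m⟩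
    all_goals simp [evalAll, Instr.eval, lowCount, lowMissing]
  refine (h1.seq (c' := w * 15 + 1 + 4) fun m₁ hm₁ => ?_).mono (by omega) fun _ => id
  refine (Ends.countdown (c := 13) I (fun j m' h => ?_) hm₁.1 hm₁.2 ?_).seq fun m₂ hm₂ => ?_
  · rw [h.2.2.2.2.2.2 1 (by omega), hc.one]
  · rintro j m' hj hm' ⟨-, e20, e21, e23, e24, e25, hs⟩
    obtain ⟨i, hi⟩ : ∃ i, i = w - (j + 1) := ⟨_, rfl⟩
    have hi' : w - j = i + 1 := by omega
    rw [← hi] at e20 e21 e23 e24 e25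
    have e2 : m' 2 = 2 := (hs 2 (by omega)).trans hc.two
    have b20 : m' 20 < 2 ^ w := by rw [e20]; exact (Nat.div_le_self _ _).trans_lt hS
    have b21 : m' 21 < 2 ^ w := by rw [e21]; exact (Nat.div_le_self _ _).trans_lt hT
    have b23 : m' 23 ≤ i := by rw [e23]; exact lowCount_le _ _
    have b24 : m' 24 ≤ i := by rw [e24]; exact lowCount_le _ _
    have b25 : m' 25 ≤ i := by rw [e25]; exact lowMissing_le _ _ _
    refine (scanBit_ends (by simpa using e2) ?_ ?_ ?_ ?_ ?_).mono le_rfl ?_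
    any_goals simp; omega
    rintro m'' ⟨f20, f21, f22, f23, f24, f25, hs'⟩
    simp only [Function.update_of_ne, Function.update_self, ne_eq, Nat.reduceEqDiff,
      not_false_eq_true] at f20 f21 f22 f23 f24 f25
    refine ⟨f22, by omega, ?_⟩
    rw [hi', lowCount_succ, lowCount_succ, lowMissing_succ, pow_succ, ← Nat.div_div_eq_div_mul,
      ← Nat.div_div_eq_div_mul, ← e20, ← e21, ← e23, ← e24, ← e25]
    exact ⟨f20, f21, f23, f24, f25, hs.trans (hs'.update_left (by omega) (by omega))⟩
  · obtain ⟨-, -, -, -, e23, e24, e25, hs⟩ := hm₂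
    rw [Nat.sub_zero] at e23 e24 e25
    have b23 : m₂ 23 ≤ w := by rw [e23]; exact lowCount_le _ _
    have b24 : m₂ 24 ≤ w := by rw [e24]; exact lowCount_le _ _
    have b25 : m₂ 25 ≤ w := by rw [e25]; exact lowMissing_le _ _ _
    have := hscale _ b24
    refine Ends.block ?_ ⟨?_, ?_,
      hs.trans (SameOutside.evalAll (by simp [Instr.WritesFrom]) m₂)⟩
    · simp [FitsAll, Instr.Fits, Instr.eval, this]
      omega
    · simp [evalAll, Instr.eval, e23, card_bits_eq_lowCount hS]
    · rw [Covers, card_bits_eq_lowCount hS, card_bits_eq_lowCount hT, ← e24, ← e23,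
        ← Nat.le_floor_iff (by positivity), ← lowMissing_eq_zero_iff hT, ← e25]
      simp [evalAll, Instr.eval]
      omega

end

/-! ### Correctness and step count of the greedy phase -/

/-- The list that is stored from cell `40` on is `G`, with length `g` in cell `5`. -/
structure HasList (k g : ℕ) (G : ℕ → ℕ) (m : Memory) : Prop where
  length : m 5 = g
  entry : ∀ i, m (i + 40) = G i
  lt : ∀ i < g, G i < 2 ^ k
  length_le : g ≤ 2 ^ k

lemma HasList.congr {k g b : ℕ} {G : ℕ → ℕ} {m m' : Memory} (h : HasList k g G m)
    (hs : SameOutside b m m') (hb : 6 ≤ b) : HasList k g G m' :=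
  ⟨(hs 5 (by omega)).trans h.length, fun i => (hs _ (by omega)).trans (h.entry i), h.lt,
    h.length_le⟩

/-- The recursion behind the counting loop of `computeGain`, which runs through the candidates in
descending order. -/
lemma card_filter_le_eq (D : Finset ℕ) (j : ℕ) :
    (D.filter (fun T => j ≤ T)).card =
      (D.filter (fun T => j + 1 ≤ T)).card + if j ∈ D then 1 else 0 := by
  have h : D.filter (fun T => j ≤ T) = D.filter (fun T => j + 1 ≤ T) ∪ D.filter (fun T => T = j) := by
    ext T; simp only [mem_filter, mem_union]; constructor
    · rintro ⟨h, h'⟩; rcases h'.eq_or_lt with e | e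
      · exact Or.inr ⟨h, e.symm⟩
      · exact Or.inl ⟨h, e⟩
    · rintro (⟨h, h'⟩ | ⟨h, rfl⟩)
      · exact ⟨h, by omega⟩
      · exact ⟨h, le_rfl⟩
  rw [h, card_union_of_disjoint, filter_eq']
  · split_ifs <;> simp
  · rw [disjoint_left]
    intro T h1 h2
    have := (mem_filter.1 h1).2
    have := (mem_filter.1 h2).2
    omega

section

variable {α : ℝ} {n : ℕ} {F : Set (Finset (Fin n))} {L r k g : ℕ} {G : ℕ → ℕ}

lemma HasRoom.ne_zero (hr : HasRoom α r k L) : L ≠ 0 := by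
  rintro rfl
  have := hr.const_le
  rw [pow_zero] at this
  omega

lemma HasRoom.pow_le (hr : HasRoom α r k L) : 2 ^ k ≤ 2 ^ (r * k) :=
  Nat.pow_le_pow_right two_pos (Nat.le_mul_of_pos_left k hr.pos)

open Classical in
lemma testElement_ends (hα : 0 ≤ α) (hr : HasRoom α r k L) {m : Memory}
    (hc : HasConstants r k m) (hl : HasList k g G m) (hS : m 11 < 2 ^ k) (hT : m 13 < 2 ^ k)
    (h12 : m 12 + 1 < 2 ^ L) :
    Ends α F L testElement m (2 ^ k * (15 * (r * k) + 18) + 15 * (r * k) + 20)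
      (fun m' => m' 12 = m 12 +
          (if m 13 ∈ (uncovered α (2 ^ k) G g).filter (fun T => Covers α (m 11) T) then 1 else 0) ∧
        m' 13 = m 13 ∧ SameOutside 12 m m') := by
  have hroom := hr.const_le
  have hroom' := hr.address_le
  have hpow := hr.pow_le
  have hg := hl.length_le
  -- The loop descends, so the flag reports on the list entries with index at least j.
  let I : ℕ → Memory → Prop := fun j m' =>
    (m' 14 = if ∀ i < g, j ≤ i → ¬ Covers α (G i) (m 13) then 1 else 0) ∧ SameOutside 14 m m'
  have h1 : Ends α F L (block [.const 14 1, .copy 15 5]) m 3 (fun m' => m' 15 = g ∧ I g m') := by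
    refine Ends.block (by simp [FitsAll, Instr.Fits, hr.ne_zero])
      ⟨by simp [evalAll, Instr.eval, hl.length],
      ?_, SameOutside.evalAll (by simp [Instr.WritesFrom]) m⟩
    rw [if_pos fun i hi hi' => absurd hi (by omega)]
    simp [evalAll, Instr.eval]
  have h2 : ∀ m₁, m₁ 15 = g ∧ I g m₁ → Ends α F L (countdown 15
      (.seq (block [.add 16 15 7, .load 20 16, .copy 21 13])
      (.seq scan (.ite 28 .skip (.instr (.const 14 0)))))) m₁ (g * (15 * (r * k) + 18) + 1)
      (fun m' => m' 15 = 0 ∧ I 0 m') := by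
    intro m₁ hm₁
    refine Ends.countdown (c := 15 * (r * k) + 16) I (fun j m' h => ?_) hm₁.1 hm₁.2 ?_
    · rw [h.2 1 (by omega), hc.one]
    · rintro j m' hj hm' ⟨e14, hs⟩
      have hj40 : m' (j + 40) = G j := (hs _ (by omega)).trans (hl.entry j)
      have e7 : m' 7 = 40 := (hs 7 (by omega)).trans hc.base
      have e13 : m' 13 = m 13 := hs 13 (by omega)
      have hb : Ends α F L (block [.add 16 15 7, .load 20 16, .copy 21 13])
          (Function.update m' 15 j) 4 (fun m'' => m'' 20 = G j ∧ m'' 21 = m 13 ∧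
            m'' 15 = j ∧ m'' 14 = m' 14 ∧ SameOutside 14 m m'') := by
        refine Ends.block ?_ ⟨?_, ?_, ?_, ?_, hs.trans ((SameOutside.evalAll
          (by simp [Instr.WritesFrom]) _).update_left (by omega) (by omega))⟩
        · simp [FitsAll, Instr.Fits, e7]; omega
        all_goals simp [evalAll, Instr.eval, e7, e13]
        simp [hj40]
      refine (hb.seq (c' := 15 * (r * k) + 10 + 2) fun m₂ hm₂ => ?_).mono (by omega) fun _ => id
      obtain ⟨f20, f21, f15, f14, fs⟩ := hm₂
      have b20 : m₂ 20 < 2 ^ (r * k) := by rw [f20]; exact (hl.lt j hj).trans_le hpow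
      have b21 : m₂ 21 < 2 ^ (r * k) := by rw [f21]; omega
      refine (scan_ends hα hr (hc.congr fs (by omega)) b20 b21).seq fun m₃ hm₃ => ?_
      obtain ⟨-, k28, ks⟩ := hm₃
      rw [f20, f21] at k28
      have k15 : m₃ 15 = j := (ks 15 (by omega)).trans f15
      have k14 : m₃ 14 = m' 14 := (ks 14 (by omega)).trans f14
      have ks' : SameOutside 14 m m₃ := fs.trans (ks.mono (by omega))
      have hiff : (∀ i < g, j ≤ i → ¬ Covers α (G i) (m 13)) ↔
          ¬ Covers α (G j) (m 13) ∧ ∀ i < g, j + 1 ≤ i → ¬ Covers α (G i) (m 13) := by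
        constructor
        · exact fun h => ⟨h j hj le_rfl, fun i hi hi' => h i hi (by omega)⟩
        · rintro ⟨h, h'⟩ i hi hi'
          rcases hi'.eq_or_lt with rfl | e
          · exact h
          · exact h' i hi e
      refine Ends.ite (fun h28 => Ends.skip ⟨k15, ?_, ks'⟩) (fun h28 => Ends.instr ?_ ⟨?_, ?_, ?_⟩)
      · have : ¬ Covers α (G j) (m 13) := fun h => h28 (k28.2 h)
        rw [k14, e14]
        simp only [hiff, this, not_false_eq_true, true_and]
      · simp [Instr.Fits]
      · simpa [Instr.eval] using k15
      · have : Covers α (G j) (m 13) := k28.1 h28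
        rw [if_neg fun h => h j hj le_rfl this]
        simp [Instr.eval]
      · exact ks'.trans (SameOutside.eval (by simp [Instr.WritesFrom]) _)
  have h3 : ∀ m₁, m₁ 15 = 0 ∧ I 0 m₁ → Ends α F L (block [.copy 20 11, .copy 21 13]) m₁ 3
      (fun m' => m' 20 = m 11 ∧ m' 21 = m 13 ∧ m' 14 = m₁ 14 ∧ SameOutside 14 m m') := by
    rintro m₁ ⟨-, -, hs⟩
    have e11 : m₁ 11 = m 11 := hs 11 (by omega)
    have e13 : m₁ 13 = m 13 := hs 13 (by omega)
    refine Ends.block (by simp [FitsAll, Instr.Fits]) ⟨?_, ?_, ?_,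
      hs.trans (SameOutside.evalAll (by simp [Instr.WritesFrom]) m₁)⟩
    all_goals simp [evalAll, Instr.eval, e11, e13]
  refine (h1.seq (c' := g * (15 * (r * k) + 18) + 1 + (3 + (15 * (r * k) + 10 + (2 + 1))))
    fun m₁ hm₁ => (h2 m₁ hm₁).seq fun m₂ hm₂ => (h3 m₂ hm₂).seq fun m₃ hm₃ => ?_).mono ?_
    fun _ => id
  · obtain ⟨f20, f21, f14, fs⟩ := hm₃
    have b20 : m₃ 20 < 2 ^ (r * k) := by rw [f20]; omega
    have b21 : m₃ 21 < 2 ^ (r * k) := by rw [f21]; omega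
    refine (scan_ends hα hr (hc.congr fs (by omega)) b20 b21).seq fun m₄ hm₄ => ?_
    obtain ⟨-, k28, ks⟩ := hm₄
    rw [f20, f21] at k28
    have k14 : m₄ 14 = m₂ 14 := (ks 14 (by omega)).trans f14
    have ks' : SameOutside 14 m m₄ := fs.trans (ks.mono (by omega))
    have e14 := hm₂.2.1
    simp only [zero_le, forall_const] at e14
    have hite : Ends α F L (.ite 28 (.instr (.const 14 0)) .skip) m₄ 2 (fun m' =>
        (m' 14 = if m 13 ∈ (uncovered α (2 ^ k) G g).filter (fun T => Covers α (m 11) T)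
          then 1 else 0) ∧ SameOutside 14 m m') := by
      refine Ends.ite (fun h28 => Ends.instr ?_ ⟨?_, ?_⟩) (fun h28 => Ends.skip ⟨?_, ks'⟩)
      · simp [Instr.Fits]
      · have : ¬ Covers α (m 11) (m 13) := fun h => h28 (k28.2 h)
        simp [Instr.eval, this]
      · exact ks'.trans (SameOutside.eval (by simp [Instr.WritesFrom]) _)
      · have : Covers α (m 11) (m 13) := k28.1 h28
        rw [k14, e14]
        simp only [mem_filter, mem_uncovered, this, hT, true_and, and_true]
    refine hite.seq fun m₅ hm₅ => Ends.instr ?_ ⟨?_, ?_, ?_⟩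
    · have : m₅ 12 = m 12 := hm₅.2 12 (by omega)
      simp only [Instr.Fits, this, hm₅.1]
      split_ifs <;> omega
    · have : m₅ 12 = m 12 := hm₅.2 12 (by omega)
      rw [Instr.eval, Function.update_self, this, hm₅.1]
    · simpa [Instr.eval] using hm₅.2 13 (by omega)
    · exact (hm₅.2.mono (by omega)).trans (SameOutside.eval (by simp [Instr.WritesFrom]) _)
  · have := Nat.mul_le_mul_right (15 * (r * k) + 18) hg
    omega

/-- A bound for the number of steps for testing one element. -/
def testSteps (r k : ℕ) : ℕ := 2 ^ k * (15 * (r * k) + 18) + 15 * (r * k) + 20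

lemma uncovered_subset : uncovered α (2 ^ k) G g ⊆ range (2 ^ k) :=
  fun _ hT => mem_range.2 (mem_uncovered.1 hT).1

lemma computeGain_ends (hα : 0 ≤ α) (hr : HasRoom α r k L) {m : Memory}
    (hc : HasConstants r k m) (hl : HasList k g G m) (hS : m 11 < 2 ^ k) :
    Ends α F L computeGain m (2 ^ k * (testSteps r k + 2) + 4)
      (fun m' => m' 12 = gain α (2 ^ k) G g (m 11) ∧ SameOutside 12 m m') := by
  classical
  have hroom := hr.const_le
  have hroom' := hr.address_le
  have hpow := hr.pow_le
  set D := (uncovered α (2 ^ k) G g).filter (fun T => Covers α (m 11) T) with hD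
  have hDle : D ⊆ range (2 ^ k) := (filter_subset _ _).trans uncovered_subset
  let I : ℕ → Memory → Prop := fun j m' =>
    m' 12 = (D.filter (fun T => j ≤ T)).card ∧ SameOutside 12 m m'
  have h1 : Ends α F L (block [.const 12 0, .copy 13 4]) m 3
      (fun m' => m' 13 = 2 ^ k ∧ I (2 ^ k) m') := by
    refine Ends.block (by simp [FitsAll, Instr.Fits])
      ⟨by simp [evalAll, Instr.eval, hc.modulus], ?_,
        SameOutside.evalAll (by simp [Instr.WritesFrom]) m⟩
    rw [filter_false_of_mem fun T hT => not_le.2 (mem_range.1 (hDle hT))]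
    simp [evalAll, Instr.eval]
  refine (h1.seq (c' := 2 ^ k * (testSteps r k + 2) + 1) fun m₁ hm₁ =>
    (Ends.countdown (c := testSteps r k) I (fun j m' h => ?_) hm₁.1 hm₁.2 ?_).mono le_rfl ?_).mono
    (by omega) fun _ => id
  · rw [h.2 1 (by omega), hc.one]
  · rintro j m' hj hm' ⟨e12, hs⟩
    have hs' : SameOutside 12 m (Function.update m' 13 j) :=
      hs.trans (SameOutside.update_left (.refl 12 _) (by omega) (by omega))
    have e11 : Function.update m' 13 j 11 = m 11 := hs' 11 (by omega)
    have u12 : Function.update m' 13 j 12 = m' 12 := by simp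
    have b12 : m' 12 ≤ 2 ^ k := by
      rw [e12]
      simpa using card_le_card ((filter_subset _ _).trans hDle)
    refine (testElement_ends hα hr (hc.congr hs' (by omega)) (hl.congr hs' (by omega))
      (by rw [e11]; exact hS) (by simpa using hj) (by rw [u12]; omega)).mono le_rfl ?_
    rintro m'' ⟨f12, f13, fs⟩
    rw [Function.update_self] at f12 f13
    refine ⟨f13, ?_, hs'.trans fs⟩
    rw [f12, u12, e11, e12, card_filter_le_eq D j]
  · rintro m' ⟨-, e12, hs⟩
    refine ⟨?_, hs⟩
    rw [e12, gain, hD]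
    simp

/-- A bound for the number of steps for one round of the greedy algorithm. -/
def roundSteps (r k : ℕ) : ℕ := 2 ^ k * (2 ^ k * (testSteps r k + 2) + 12) + 10

lemma findBest_ends (hα : 0 ≤ α) (hr : HasRoom α r k L) {m : Memory}
    (hc : HasConstants r k m) (hl : HasList k g G m) :
    Ends α F L findBest m (roundSteps r k)
      (fun m' => m' 10 < 2 ^ k ∧ m' 9 = gain α (2 ^ k) G g (m' 10) ∧
        (∀ S < 2 ^ k, gain α (2 ^ k) G g S ≤ m' 9) ∧ SameOutside 9 m m') := by
  -- Only an inequality for cell `9`: it starts at 0 together with cell `10`, although the set 0 may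
  -- have positive gain. Equality follows at the end, because cell `9` then bounds every gain, that
  -- of cell `10` included.
  let I : ℕ → Memory → Prop := fun j m' => m' 10 < 2 ^ k ∧
    m' 9 ≤ gain α (2 ^ k) G g (m' 10) ∧
    (∀ S < 2 ^ k, j ≤ S → gain α (2 ^ k) G g S ≤ m' 9) ∧ SameOutside 9 m m'
  have h1 : Ends α F L (block [.const 9 0, .const 10 0, .copy 11 4]) m 4
      (fun m' => m' 11 = 2 ^ k ∧ I (2 ^ k) m') := by
    refine Ends.block (by simp [FitsAll, Instr.Fits])
      ⟨by simp [evalAll, Instr.eval, hc.modulus], ?_, ?_, fun S h h' => absurd h (by omega),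
        SameOutside.evalAll (by simp [Instr.WritesFrom]) m⟩
    all_goals simp [evalAll, Instr.eval]
  refine (h1.seq (c' := 2 ^ k * (2 ^ k * (testSteps r k + 2) + 12) + 1) fun m₁ hm₁ =>
    (Ends.countdown (c := 2 ^ k * (testSteps r k + 2) + 10) I (fun j m' h => ?_)
      hm₁.1 hm₁.2 ?_).mono le_rfl ?_).mono (by rw [roundSteps]; omega) fun _ => id
  · rw [h.2.2.2 1 (by omega), hc.one]
  · rintro j m' hj hm' ⟨e10, e9, emax, hs⟩
    have hs' : SameOutside 9 m (Function.update m' 11 j) :=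
      hs.trans (SameOutside.update_left (.refl 9 _) (by omega) (by omega))
    have hgain := computeGain_ends (F := F) hα hr (hc.congr hs' (by omega))
      (hl.congr hs' (by omega)) (by simpa using hj)
    rw [Function.update_self] at hgain
    refine (hgain.seq (c' := 1 + (3 + 1)) fun m₂ hm₂ => ?_).mono (by omega) fun _ => id
    obtain ⟨f12, fs⟩ := hm₂
    have f9 : m₂ 9 = m' 9 := by simpa using fs 9 (by omega)
    have f10 : m₂ 10 = m' 10 := by simpa using fs 10 (by omega)
    have f11 : m₂ 11 = j := by simpa using fs 11 (by omega)
    have fs' : SameOutside 9 m m₂ := hs'.trans (fs.mono (by omega))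
    refine (Ends.instr (i := .sub 16 12 9)
      (Q := fun m₃ => m₃ = Function.update m₂ 16 (m₂ 12 - m₂ 9)) trivial rfl).seq
      fun m₃ hm₃ => ?_
    have ks : SameOutside 9 m m₃ :=
      fs'.trans (hm₃ ▸ SameOutside.update_left (.refl 9 _) (by omega) (by omega))
    have k16 : m₃ 16 = gain α (2 ^ k) G g j - m' 9 := by simp [hm₃, f12, f9]
    have k9 : m₃ 9 = m' 9 := by simp [hm₃, f9]
    have k10 : m₃ 10 = m' 10 := by simp [hm₃, f10]
    have k11 : m₃ 11 = j := by simp [hm₃, f11]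
    have k12 : m₃ 12 = gain α (2 ^ k) G g j := by simp [hm₃, f12]
    refine Ends.ite (fun h16 => Ends.block ?_ ⟨?_, ?_, ?_, ?_,
      ks.trans (SameOutside.evalAll (by simp [Instr.WritesFrom]) _)⟩)
      (fun h16 => (Ends.skip ⟨k11, ?_, ?_, ?_, ks⟩).mono (by omega) fun _ => id)
    · simp [FitsAll, Instr.Fits]
    · simp [evalAll, Instr.eval, k11]
    · simpa [evalAll, Instr.eval, k11] using hj
    · simp [evalAll, Instr.eval, k11, k12]
    · simp only [evalAll, Instr.eval]
      simp only [Function.update_self, Function.update_of_ne, ne_eq, Nat.reduceEqDiff,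
        not_false_eq_true, k12]
      intro S hS hS'
      rcases hS'.eq_or_lt with rfl | e
      · exact le_rfl
      · exact (emax S hS e).trans (by omega)
    · rw [k10]; exact e10
    · rw [k9, k10]; exact e9
    · intro S hS hS'
      rw [k9]
      rcases hS'.eq_or_lt with rfl | e
      · omega
      · exact emax S hS e
  · rintro m' ⟨-, e10, e9, emax, hs⟩
    exact ⟨e10, le_antisymm e9 (emax _ e10 (Nat.zero_le _)),
      fun S hS => emax S hS (Nat.zero_le _), hs⟩

/-- A bound for the number of steps of the greedy algorithm. -/
def coveringSteps (r k : ℕ) : ℕ := 2 ^ k * (roundSteps r k + 7) + 4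

/-- The list is read off the memory from cell `40` on. A round with positive gain appends a set and
is an instance of `IsGreedy.step`; any other round leaves the list alone and falls under
`IsGreedy.step_of_gain_eq_zero`. -/
lemma computeCovering_ends (hα : 1 ≤ α) (hr : HasRoom α r k L) {m : Memory}
    (hc : HasConstants r k m) :
    Ends α F L computeCovering m (coveringSteps r k)
      (fun m' => IsGreedy α k 0 (m' 5) (fun i => m' (i + 40)) ∧ HasConstants r k m') := by
  have hroom := hr.const_le
  have hroom' := hr.address_le
  have hpow := hr.pow_le
  let I : ℕ → Memory → Prop := fun j m' =>
    IsGreedy α k j (m' 5) (fun i => m' (i + 40)) ∧ HasConstants r k m'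
  have h1 : Ends α F L (block [.const 5 0, .copy 8 4]) m 3
      (fun m' => m' 8 = 2 ^ k ∧ I (2 ^ k) m') := by
    refine Ends.block (by simp [FitsAll, Instr.Fits])
      ⟨by simp [evalAll, Instr.eval, hc.modulus], ?_, ?_⟩
    · simpa [evalAll, Instr.eval] using isGreedy_zero α k _
    · constructor <;> simp [evalAll, Instr.eval, hc.one, hc.two, hc.width, hc.modulus, hc.parts,
        hc.base]
  refine (h1.seq (c' := 2 ^ k * (roundSteps r k + 7) + 1) fun m₁ hm₁ =>
    (Ends.countdown (c := roundSteps r k + 5) I (fun j m' h => h.2.one)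
      hm₁.1 hm₁.2 ?_).mono le_rfl fun _ h => h.2).mono (by rw [coveringSteps]; omega) fun _ => id
  rintro j m' hj hm' ⟨hg, hc'⟩
  have hs' : SameOutside 8 m' (Function.update m' 8 j) :=
    SameOutside.update_left (.refl 8 _) le_rfl (by omega)
  have hle := hg.length_add_le
  have hl : HasList k (m' 5) (fun i => m' (i + 40)) m' :=
    ⟨rfl, fun _ => rfl, hg.lt, by omega⟩
  refine (findBest_ends (by linarith) hr (hc'.congr hs' le_rfl) (hl.congr hs' (by omega))).seq
    (c' := 4 + 1) fun m₂ hm₂ => ?_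
  obtain ⟨f10, f9, fmax, fs⟩ := hm₂
  have f8 : m₂ 8 = j := by simpa using fs 8 (by omega)
  have fs' : SameOutside 8 m' m₂ := hs'.trans (fs.mono (by omega))
  have f5 : m₂ 5 = m' 5 := fs' 5 (by omega)
  have f7 : m₂ 7 = 40 := (fs' 7 (by omega)).trans hc'.base
  have f1 : m₂ 1 = 1 := (fs' 1 (by omega)).trans hc'.one
  have fG : ∀ i, m₂ (i + 40) = m' (i + 40) := fun i => fs' _ (by omega)
  have fc := hc'.congr fs' le_rfl
  refine Ends.ite (fun h9 => (Ends.block ?_ ⟨?_, ?_, ?_⟩))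
    (fun h9 => (Ends.skip ⟨f8, ?_, fc⟩).mono (by omega) fun _ => id)
  · simp [FitsAll, Instr.Fits, Instr.eval, f5, f7, f1]
    omega
  · simp [evalAll, Instr.eval, f5, f7, f1, f8]
  · have e5 : evalAll α F [.add 16 5 7, .store 16 10, .add 5 5 1] m₂ 5 = m' 5 + 1 := by
      simp [evalAll, Instr.eval, f5, f7, f1]
    rw [e5]
    refine hg.step hα f10 (by rw [← f9]; exact h9) (fun R hR => by rw [← f9]; exact fmax R hR) ?_ ?_
    · intro i hi
      have : i ≠ m' 5 := by omega
      simp [evalAll, Instr.eval, f5, f7, f1, this, fG]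
    · simp [evalAll, Instr.eval, f5, f7, f1]
  · constructor <;> simp [evalAll, Instr.eval, f5, f7, f1, fc.two, fc.width,
      fc.modulus, fc.parts]
  · rw [f5]
    refine (hg.step_of_gain_eq_zero hα fun S hS => ?_).congr fun i _ => fG i
    have := fmax S hS
    omega

end

/-! ### Correctness and step count of the search over products of covers -/

lemma card_bits_two_pow_sub_one (w : ℕ) : (bits (2 ^ w - 1)).card = w := by
  have : bits (2 ^ w - 1) = range w := by
    ext i
    simp [Nat.testBit_two_pow_sub_one]
  rw [this, card_range]

lemma decode_two_pow_sub_one {n w : ℕ} (h : n ≤ w) : decode n (2 ^ w - 1) = univ := by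
  ext i
  simp only [decode, mem_filter, mem_univ, true_and, Nat.testBit_two_pow_sub_one, iff_true,
    decide_eq_true_eq]
  exact i.2.trans_le h

section

variable {α : ℝ} {n : ℕ} {F : Set (Finset (Fin n))} {L r k g : ℕ} {G : ℕ → ℕ}

lemma computeWord_ends (hr : HasRoom α r k L) {m : Memory} (hc : HasConstants r k m)
    (hl : HasList k g G m) (hg : 0 < g) (h8 : m 8 < 2 ^ L) :
    Ends α F L computeWord m (12 * r + 6)
      (fun m' => m' 12 = word (2 ^ k) G g r (m 8) ∧ SameOutside 11 m m') := by
  have hroom := hr.const_le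
  have hroom' := hr.address_le
  have hpow := hr.pow_le
  have hgle := hl.length_le
  have hword : word (2 ^ k) G g r (m 8) < 2 ^ (r * k) := by
    rw [mul_comm, pow_mul]; exact word_lt hg hl.lt r _
  -- Digits already read, plus the place value in cell `14` times the word of the remaining digits,
  -- always give the complete word.
  let I : ℕ → Memory → Prop := fun j m' => j ≤ r ∧ m' 14 = (2 ^ k) ^ (r - j) ∧
    m' 12 + (2 ^ k) ^ (r - j) * word (2 ^ k) G g j (m' 11) = word (2 ^ k) G g r (m 8) ∧
    m' 11 < 2 ^ L ∧ SameOutside 11 m m'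
  have h1 : Ends α F L (block [.copy 11 8, .const 12 0, .const 14 1, .copy 13 6]) m 5
      (fun m' => m' 13 = r ∧ I r m') := by
    refine Ends.block (by simp [FitsAll, Instr.Fits, hr.ne_zero])
      ⟨?_, le_rfl, ?_, ?_, ?_, SameOutside.evalAll (by simp [Instr.WritesFrom]) m⟩
    all_goals simp [evalAll, Instr.eval, hc.parts, h8]
  refine (h1.seq (c' := r * (10 + 2) + 1) fun m₁ hm₁ =>
    (Ends.countdown (c := 10) I (fun j m' h => ?_) hm₁.1 hm₁.2 ?_).mono le_rfl ?_).mono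
    (by omega) fun _ => id
  · rw [h.2.2.2.2 1 (by omega), hc.one]
  · rintro j m' hj hm' ⟨-, e14, e12, e11, hs⟩
    obtain ⟨i, hi⟩ : ∃ i, i = r - (j + 1) := ⟨_, rfl⟩
    have hi' : r - j = i + 1 := by omega
    rw [← hi] at e14 e12
    have e5 : m' 5 = g := (hs 5 (by omega)).trans hl.length
    have e4 : m' 4 = 2 ^ k := (hs 4 (by omega)).trans hc.modulus
    have e7 : m' 7 = 40 := (hs 7 (by omega)).trans hc.base
    have eG : ∀ i, m' (i + 40) = G i := fun i => (hs _ (by omega)).trans (hl.entry i)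
    have hmod : m' 11 - m' 11 / g * g = m' 11 % g := by
      have := Nat.div_add_mod' (m' 11) g
      omega
    have hlt : m' 11 % g < g := Nat.mod_lt _ hg
    have hdiv : m' 11 / g * g ≤ m' 11 := Nat.div_mul_le_self _ _
    have hple : (2 ^ k) ^ i * 2 ^ k ≤ 2 ^ (r * k) := by
      rw [← pow_succ, ← pow_mul, mul_comm k]
      exact Nat.pow_le_pow_right two_pos (Nat.mul_le_mul_right k (by omega))
    have hsum : m' 12 + G (m' 11 % g) * (2 ^ k) ^ i +
        (2 ^ k) ^ (i + 1) * word (2 ^ k) G g j (m' 11 / g) = word (2 ^ k) G g r (m 8) := by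
      rw [← e12, word, pow_succ]; ring
    have hs' : SameOutside 11 m (Function.update m' 13 j) :=
      hs.trans (SameOutside.update_left (.refl 11 _) (by omega) (by omega))
    refine Ends.block ?_ ⟨?_, by omega, ?_, ?_, ?_,
      hs'.trans (SameOutside.evalAll (by simp [Instr.WritesFrom]) _)⟩
    · simp [FitsAll, Instr.Fits, Instr.eval, e5, e4, e7, e14, hmod, eG]
      refine ⟨by omega, by omega, by omega, by omega, by omega⟩
    · simp [evalAll, Instr.eval]
    · simp [evalAll, Instr.eval, hi', e14, e4, pow_succ]
    · rw [hi', ← hsum]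
      simp [evalAll, Instr.eval, e5, e4, e7, e14, hmod, eG]
    · simpa [evalAll, Instr.eval, e5] using (Nat.div_le_self _ _).trans_lt e11
  · rintro m' ⟨-, -, -, e12, -, hs⟩
    exact ⟨by simpa [word] using e12, hs⟩

lemma tryWord_ends (hα : 0 ≤ α) (hr : HasRoom α r k L) {m : Memory} (hc : HasConstants r k m)
    (hl : HasList k g G m) (hg : 0 < g) (h8 : m 8 < 2 ^ L) {x : ℕ}
    (hx : word (2 ^ k) G g r (m 8) = x) :
    Ends α F L tryWord m (15 * (r * k) + 12 * r + 26) (fun m' =>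
      ((m' 9 = m 9 ∧ m' 10 = m 10 ∧ (decode n x ∈ F → m 10 ≤ (bits x).card)) ∨
        (m' 9 = x ∧ m' 10 = (bits x).card ∧ decode n x ∈ F ∧ (bits x).card ≤ m 10)) ∧
      SameOutside 9 m m') := by
  classical
  have hxlt : x < 2 ^ (r * k) := by
    rw [← hx, mul_comm, pow_mul]; exact word_lt hg hl.lt r _
  have hw : ∀ m₁, m₁ 12 = x ∧ SameOutside 11 m m₁ →
      Ends α F L (.instr (.query 17 12)) m₁ 1 (fun m' =>
        m' 17 = (if decode n x ∈ F then 1 else 0) ∧ m' 12 = x ∧ m' 9 = m₁ 9 ∧ m' 10 = m₁ 10 ∧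
        SameOutside 11 m m') := by
    rintro m₁ ⟨e12, hs⟩
    refine Ends.instr (by simp [Instr.Fits, hr.ne_zero]) ⟨?_, ?_, ?_, ?_,
      hs.trans (SameOutside.eval (by simp [Instr.WritesFrom]) _)⟩
    all_goals simp [Instr.eval, e12]
  refine ((computeWord_ends hr hc hl hg h8).seq
    (c' := 1 + (3 + (15 * (r * k) + 10 + (1 + (3 + 1))) + 1)) fun m₁ hm₁ =>
    (hw m₁ (by rw [← hx]; exact hm₁)).seq fun m₂ hm₂ => ?_).mono (by omega) fun _ => id
  obtain ⟨e17, e12, e9, e10, hs⟩ := hm₂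
  rw [hm₁.2 9 (by omega)] at e9
  rw [hm₁.2 10 (by omega)] at e10
  refine Ends.ite (fun h17 => ?_) (fun h17 => (Ends.skip ?_).mono (by omega) fun _ => id)
  · have hmem : decode n x ∈ F := by
      by_contra h
      rw [if_neg h] at e17
      exact h17 e17
    have hb : Ends α F L (block [.copy 20 12, .copy 21 12]) m₂ 3
        (fun m' => m' 20 = x ∧ m' 21 = x ∧ SameOutside 20 m₂ m') := by
      refine Ends.block (by simp [FitsAll, Instr.Fits]) ⟨?_, ?_,
        SameOutside.evalAll (by simp [Instr.WritesFrom]) _⟩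
      all_goals simp [evalAll, Instr.eval, e12]
    refine hb.seq fun m₃ hm₃ => ?_
    obtain ⟨f20, f21, fs⟩ := hm₃
    refine (scan_ends hα hr ((hc.congr hs (by omega)).congr fs (by omega)) (f20 ▸ hxlt)
      (f21 ▸ hxlt)).seq fun m₄ hm₄ => ?_
    obtain ⟨k23, -, ks⟩ := hm₄
    rw [f20] at k23
    have ks' := fs.trans ks
    have k12 : m₄ 12 = x := (ks' 12 (by omega)).trans e12
    have k9 : m₄ 9 = m 9 := (ks' 9 (by omega)).trans e9
    have k10 : m₄ 10 = m 10 := (ks' 10 (by omega)).trans e10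
    have ks9 : SameOutside 9 m m₄ := (hs.mono (by omega)).trans (ks'.mono (by omega))
    refine (Ends.instr (i := .sub 18 10 23)
      (Q := fun m₅ => m₅ = Function.update m₄ 18 (m₄ 10 - m₄ 23)) trivial rfl).seq fun m₅ hm₅ => ?_
    have l18 : m₅ 18 = m 10 - (bits x).card := by simp [hm₅, k10, k23]
    have l9 : m₅ 9 = m 9 := by simp [hm₅, k9]
    have l10 : m₅ 10 = m 10 := by simp [hm₅, k10]
    have l12 : m₅ 12 = x := by simp [hm₅, k12]
    have l23 : m₅ 23 = (bits x).card := by simp [hm₅, k23]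
    have ls : SameOutside 9 m m₅ :=
      ks9.trans (hm₅ ▸ SameOutside.update_left (.refl 9 _) (by omega) (by omega))
    refine Ends.ite (fun h18 => Ends.block (by simp [FitsAll, Instr.Fits])
      ⟨Or.inr ⟨?_, ?_, hmem, by omega⟩,
        ls.trans (SameOutside.evalAll (by simp [Instr.WritesFrom]) _)⟩)
      (fun h18 => (Ends.skip ⟨Or.inl ⟨l9, l10, fun _ => by omega⟩, ls⟩).mono (by omega) fun _ => id)
    · simp [evalAll, Instr.eval, l12]
    · simp [evalAll, Instr.eval, l23]
  · refine ⟨Or.inl ⟨e9, e10, fun hmem => ?_⟩, hs.mono (by omega)⟩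
    rw [if_pos hmem, h17] at e17
    cases e17

/-- Cells `9` and `10` contain a member of `F` and its weight, and no word with a position from `j`
on is a member of smaller weight. -/
structure IsBest (F : Set (Finset (Fin n))) (r k g : ℕ) (G : ℕ → ℕ) (j : ℕ) (m : Memory) :
    Prop where
  mem : decode n (m 9) ∈ F
  weight_eq : m 10 = (bits (m 9)).card
  le : ∀ J < g ^ r, j ≤ J → decode n (word (2 ^ k) G g r J) ∈ F →
    m 10 ≤ (bits (word (2 ^ k) G g r J)).card

/-- A bound for the number of steps for searching words over a list of length at most `g`. -/
def searchSteps (r k g : ℕ) : ℕ := g ^ r * (15 * (r * k) + 12 * r + 28) + 5 * r + 10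

lemma searchWords_ends (hα : 0 ≤ α) (hr : HasRoom α r k L) (hn : n ≤ r * k)
    (hF : MonotoneFamily F) {m : Memory} (hc : HasConstants r k m)
    (hgr : IsGreedy α k 0 (m 5) (fun i => m (i + 40))) :
    Ends α F L searchWords m (searchSteps r k (m 5))
      (fun m' => IsApproxSolution α F (decode n (m' 0))) := by
  obtain ⟨g, hg⟩ : ∃ g, g = m 5 := ⟨_, rfl⟩
  obtain ⟨G, hG⟩ : ∃ G : ℕ → ℕ, G = fun i => m (i + 40) := ⟨_, rfl⟩
  rw [← hg, ← hG] at hgr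
  rw [← hg]
  have hpos := hgr.length_pos
  have hgle : g ≤ 2 ^ k := hgr.length_add_le
  have hl : HasList k g G m := ⟨hg.symm, fun i => by rw [hG], hgr.lt, hgle⟩
  have hroom := hr.two_mul_le
  have hpowle : ∀ i ≤ r, (2 ^ k) ^ i ≤ 2 ^ (r * k) := fun i hi => by
    rw [← pow_mul, mul_comm]
    exact Nat.pow_le_pow_right two_pos (Nat.mul_le_mul_right k hi)
  have hgpow : g ^ r ≤ 2 ^ (r * k) := (Nat.pow_le_pow_left hgle r).trans (hpowle r le_rfl)
  let I : ℕ → Memory → Prop := fun j m' => j ≤ r ∧ m' 8 = g ^ (r - j) ∧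
    m' 9 = (2 ^ k) ^ (r - j) ∧ SameOutside 8 m m'
  have h1 : Ends α F L (block [.const 8 1, .const 9 1, .copy 13 6]) m 4
      (fun m' => m' 13 = r ∧ I r m') := by
    refine Ends.block (by simp [FitsAll, Instr.Fits, hr.ne_zero])
      ⟨?_, le_rfl, ?_, ?_, SameOutside.evalAll (by simp [Instr.WritesFrom]) m⟩
    all_goals simp [evalAll, Instr.eval, hc.parts]
  have h2 : ∀ m₁, m₁ 13 = r ∧ I r m₁ → Ends α F L
      (countdown 13 (block [.mul 8 8 5, .mul 9 9 4])) m₁ (r * 5 + 1)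
      (fun m' => m' 13 = 0 ∧ I 0 m') := by
    intro m₁ hm₁
    refine Ends.countdown (c := 3) I (fun j m' h => ?_) hm₁.1 hm₁.2 ?_
    · rw [h.2.2.2 1 (by omega), hc.one]
    · rintro j m' hj hm' ⟨-, e8, e9, hs⟩
      obtain ⟨i, hi⟩ : ∃ i, i = r - (j + 1) := ⟨_, rfl⟩
      have hi' : r - j = i + 1 := by omega
      rw [← hi] at e8 e9
      have e5 : m' 5 = g := (hs 5 (by omega)).trans hg.symm
      have e4 : m' 4 = 2 ^ k := (hs 4 (by omega)).trans hc.modulus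
      have hs' : SameOutside 8 m (Function.update m' 13 j) :=
        hs.trans (SameOutside.update_left (.refl 8 _) (by omega) (by omega))
      have b1 := hpowle (i + 1) (by omega)
      have b2 : g ^ (i + 1) ≤ (2 ^ k) ^ (i + 1) := Nat.pow_le_pow_left hgle _
      rw [pow_succ] at b1
      rw [pow_succ, pow_succ] at b2
      refine Ends.block ?_ ⟨?_, by omega, ?_, ?_,
        hs'.trans (SameOutside.evalAll (by simp [Instr.WritesFrom]) _)⟩
      · simp [FitsAll, Instr.Fits, Instr.eval, e5, e4, e8, e9]
        omega
      · simp [evalAll, Instr.eval]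
      · simp [evalAll, Instr.eval, hi', e8, e5, pow_succ]
      · simp [evalAll, Instr.eval, hi', e9, e4, pow_succ]
  let K : ℕ → Memory → Prop := fun j m' => IsBest F r k g G j m' ∧ SameOutside 8 m m'
  have h3 : ∀ m₁, m₁ 13 = 0 ∧ I 0 m₁ → Ends α F L (block [.sub 9 9 1, .copy 10 3]) m₁ 3
      (fun m' => m' 8 = g ^ r ∧ K (g ^ r) m') := by
    rintro m₁ ⟨-, -, e8, e9, hs⟩
    rw [Nat.sub_zero] at e8 e9
    have e3 : m₁ 3 = r * k := (hs 3 (by omega)).trans hc.width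
    have e1 : m₁ 1 = 1 := (hs 1 (by omega)).trans hc.one
    have e9' : m₁ 9 = 2 ^ (r * k) := by rw [e9, ← pow_mul, mul_comm]
    refine Ends.block (by simp [FitsAll, Instr.Fits]) ⟨?_, ⟨?_, ?_, fun J h h' => ?_⟩,
      hs.trans (SameOutside.evalAll (by simp [Instr.WritesFrom]) _)⟩
    · simp [evalAll, Instr.eval, e8]
    · simpa [evalAll, Instr.eval, e9', e1, decode_two_pow_sub_one hn] using hF.1
    · simp [evalAll, Instr.eval, e9', e1, e3, card_bits_two_pow_sub_one]
    · omega
  have h4 : ∀ m₁, m₁ 8 = g ^ r ∧ K (g ^ r) m₁ → Ends α F L (countdown 8 tryWord) m₁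
      (g ^ r * (15 * (r * k) + 12 * r + 28) + 1) (fun m' => m' 8 = 0 ∧ K 0 m') := by
    intro m₁ hm₁
    refine Ends.countdown (c := 15 * (r * k) + 12 * r + 26) K (fun j m' h => ?_) hm₁.1 hm₁.2 ?_
    · rw [h.2 1 (by omega), hc.one]
    · rintro j m' hj hm' ⟨hb, hs⟩
      have hs' : SameOutside 8 m (Function.update m' 8 j) :=
        hs.trans (SameOutside.update_left (.refl 8 _) (by omega) (by omega))
      have u8 : Function.update m' 8 j 8 = j := Function.update_self ..
      have u9 : Function.update m' 8 j 9 = m' 9 := by simp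
      have u10 : Function.update m' 8 j 10 = m' 10 := by simp
      refine (tryWord_ends (F := F) hα hr (hc.congr hs' le_rfl) (hl.congr hs' (by omega)) hpos
        (by rw [u8]; omega) (by rw [u8])).mono le_rfl ?_
      rintro m'' ⟨hor, fs⟩
      rw [u9, u10] at hor
      refine ⟨(fs 8 (by omega)).trans u8, ?_, hs'.trans (fs.mono (by omega))⟩
      rcases hor with ⟨f9, f10, hle⟩ | ⟨f9, f10, hmem, hle⟩
      · refine ⟨by rw [f9]; exact hb.mem, by rw [f9, f10]; exact hb.weight_eq, ?_⟩
        intro J hJ hJ' hJF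
        rw [f10]
        rcases hJ'.eq_or_lt with rfl | e
        · exact hle hJF
        · exact hb.le J hJ e hJF
      · refine ⟨by rw [f9]; exact hmem, by rw [f9, f10], ?_⟩
        intro J hJ hJ' hJF
        rw [f10]
        rcases hJ'.eq_or_lt with rfl | e
        · exact le_rfl
        · exact hle.trans (hb.le J hJ e hJF)
  refine (h1.seq fun m₁ hm₁ => (h2 m₁ hm₁).seq fun m₂ hm₂ => (h3 m₂ hm₂).seq fun m₃ hm₃ =>
    (h4 m₃ hm₃).seq (R := fun m' => IsApproxSolution α F (decode n (m' 0))) (c' := 1)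
    fun m₄ hm₄ => ?_).mono (by rw [searchSteps]; omega) fun _ => id
  obtain ⟨-, hb, -⟩ := hm₄
  refine Ends.instr (i := .copy 0 9) trivial ?_
  rw [Instr.eval, Function.update_self]
  exact hgr.isApproxSolution (by rw [mul_comm]; exact hn) hF hb.mem fun J hJ hJF => by
    rw [← hb.weight_eq]; exact hb.le J hJ (Nat.zero_le _) hJF

lemma initConstants_ends (hr : HasRoom α r (n / r + 1) L) :
    Ends α F L (initConstants r) (initMemory n) (4 * (n / r + 1) + 11)
      (HasConstants r (n / r + 1)) := by
  obtain ⟨k, hk⟩ : ∃ k, k = n / r + 1 := ⟨_, rfl⟩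
  rw [← hk] at hr ⊢
  have hroom := hr.const_le
  have hroom' := hr.address_le
  have hpow := hr.pow_le
  have hkle : k ≤ 2 ^ (r * k) :=
    (Nat.le_mul_of_pos_left k hr.pos).trans Nat.lt_two_pow_self.le
  have hrk : k * r ≤ 2 ^ (r * k) := by rw [mul_comm]; exact Nat.lt_two_pow_self.le
  let I : ℕ → Memory → Prop := fun j m' => j ≤ k ∧ m' 1 = 1 ∧ m' 2 = 2 ∧ m' 3 = r * k ∧
    m' 4 = 2 ^ (k - j) ∧ m' 6 = r ∧ m' 7 = 40
  have h1 : Ends α F L (block [.const 1 1, .const 2 2, .const 7 40, .const 6 r, .div 3 0 6,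
      .add 3 3 1, .copy 11 3, .mul 3 3 6, .const 4 1]) (initMemory n) 10
      (fun m' => m' 11 = k ∧ I k m') := by
    refine Ends.block ?_ ⟨?_, le_rfl, ?_, ?_, ?_, ?_, ?_, ?_⟩
    · simp [FitsAll, Instr.Fits, Instr.eval, initMemory, hr.ne_zero, ← hk]
      omega
    all_goals simp [evalAll, Instr.eval, initMemory, ← hk, mul_comm]
  refine (h1.seq (c' := k * 4 + 1) fun m₁ hm₁ =>
    (Ends.countdown (c := 2) I (fun j m' h => h.2.1) hm₁.1 hm₁.2 ?_).mono le_rfl ?_).mono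
    (by omega) fun _ => id
  · rintro j m' hj hm' ⟨-, e1, e2, e3, e4, e6, e7⟩
    have hj' : k - j = (k - (j + 1)) + 1 := by omega
    have hle : 2 ^ (k - j) ≤ 2 ^ k := Nat.pow_le_pow_right two_pos (by omega)
    rw [hj', pow_succ] at hle
    refine Ends.block ?_ ⟨?_, by omega, ?_, ?_, ?_, ?_, ?_, ?_⟩
    · simp [FitsAll, Instr.Fits, e2, e4]
      omega
    · simp [evalAll, Instr.eval]
    · simp [evalAll, Instr.eval, e1]
    · simp [evalAll, Instr.eval, e2]
    · simp [evalAll, Instr.eval, e3]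
    · simp [evalAll, Instr.eval, e4, e2, hj', pow_succ]
    · simp [evalAll, Instr.eval, e6]
    · simp [evalAll, Instr.eval, e7]
  · rintro m' ⟨-, -, e1, e2, e3, e4, e6, e7⟩
    exact ⟨e1, e2, e3, e4, e6, e7⟩

/-- A bound for the length of the greedy covering. -/
noncomputable def coveringLength (α : ℝ) (k : ℕ) : ℕ := ⌊coverWeight α k * k + 1⌋₊

lemma coveringSearch_ends (hα : 1 ≤ α) (hr : HasRoom α r (n / r + 1) L)
    (hF : MonotoneFamily F) :
    Ends α F L (coveringSearch r) (initMemory n)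
      (4 * (n / r + 1) + 11 + (coveringSteps r (n / r + 1) +
        searchSteps r (n / r + 1) (coveringLength α (n / r + 1))))
      (fun m' => IsApproxSolution α F (decode n (m' 0))) := by
  have hn : n ≤ r * (n / r + 1) := (Nat.lt_mul_div_succ n hr.pos).le
  refine (initConstants_ends hr).seq fun m₁ hm₁ => (computeCovering_ends hα hr hm₁).seq
    fun m₂ hm₂ => (searchWords_ends (by linarith) hr hn hF hm₂.2 hm₂.1).mono ?_ fun _ => id
  have : m₂ 5 ≤ coveringLength α (n / r + 1) := Nat.le_floor hm₂.1.length_le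
  unfold searchSteps
  gcongr

end

/-! ### Number sizes and the total running time -/

/-- The number of bits that the program needs for its numbers. -/
noncomputable def wordLength (α : ℝ) (r k : ℕ) : ℕ := r * k + (⌈α⌉₊ + r + 60)

/-- Every bound required is at most 2^(rk) times a constant a ≤ ⌈α⌉ + r + 60, and a constant K is
below 2^K. So the word length is linear in rk. -/
lemma hasRoom_wordLength {α : ℝ} {r : ℕ} (hr : 0 < r) (k : ℕ) :
    HasRoom α r k (wordLength α r k) := by
  obtain ⟨K, hK⟩ : ∃ K, K = ⌈α⌉₊ + r + 60 := ⟨_, rfl⟩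
  have h1 : r * k < 2 ^ (r * k) := Nat.lt_two_pow_self
  have hL : 2 ^ (r * k) * K < 2 ^ wordLength α r k := by
    rw [wordLength, ← hK, pow_add]
    exact Nat.mul_lt_mul_of_pos_left Nat.lt_two_pow_self (Nat.two_pow_pos _)
  have hle : ∀ a ≤ K, 2 ^ (r * k) * a < 2 ^ wordLength α r k := fun a ha =>
    (Nat.mul_le_mul_left _ ha).trans_lt hL
  have hX : 0 < 2 ^ (r * k) := Nat.two_pow_pos _
  refine ⟨hr, ?_, ?_, ?_, fun i hi => ?_⟩
  · exact (Nat.le_mul_of_pos_left _ hX).trans_lt (hle (r + 50) (by omega))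
  · rw [mul_comm]; exact hle 2 (by omega)
  · have := hle 41 (by omega)
    omega
  · have hceil : α ≤ (⌈α⌉₊ : ℝ) := Nat.le_ceil α
    have hc := hle ⌈α⌉₊ (by omega)
    generalize ⌈α⌉₊ = a at hceil hc
    have : α * (i : ℝ) ≤ ((i * a : ℕ) : ℝ) := by
      rw [Nat.cast_mul, mul_comm]
      exact mul_le_mul_of_nonneg_left hceil (Nat.cast_nonneg i)
    exact (Nat.floor_le_of_le this).trans_lt
      ((Nat.mul_le_mul_right a (hi.trans h1.le)).trans_lt hc)

/-- The running time of the program. -/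
noncomputable def runningTime (α : ℝ) (r n : ℕ) : ℕ :=
  (4 * (n / r + 1) + 11 + (coveringSteps r (n / r + 1) +
    searchSteps r (n / r + 1) (coveringLength α (n / r + 1)))) *
      (2 * wordLength α r (n / r + 1) + 1)

lemma isDeterministicApprox_coveringSearch {α : ℝ} (hα : 1 ≤ α) {r : ℕ} (hr : 0 < r) :
    IsDeterministicApprox α (coveringSearch r) (runningTime α r) := by
  intro n F hF
  have hroom := hasRoom_wordLength (α := α) hr (n / r + 1)
  have hn : n < 2 ^ wordLength α r (n / r + 1) := by
    have h1 : n ≤ r * (n / r + 1) := (Nat.lt_mul_div_succ n hr).le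
    have h2 : r * (n / r + 1) < 2 ^ (r * (n / r + 1)) := Nat.lt_two_pow_self
    have := hroom.address_le
    omega
  obtain ⟨m, t, hx, ht, -, hs⟩ := coveringSearch_ends (F := F) hα hroom hF (fun i => by
    rw [initMemory, Function.update_apply]
    split_ifs
    · exact hn
    · exact Nat.two_pow_pos _)
  exact ⟨m, t, hx, ht, hs⟩

/-- Four nested loops of length at most 2^k: greedy rounds, candidate sets, elements to be covered,
list entries. The scan inside them contributes the linear factor. -/
lemma coveringSteps_le (r k : ℕ) : coveringSteps r k ≤ 16 ^ k * (30 * (r * k) + 73) := by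
  have h16 : 16 ^ k = 2 ^ k * (2 ^ k * (2 ^ k * 2 ^ k)) := by
    rw [← mul_pow, ← mul_pow, ← mul_pow]; norm_num
  have hX : 1 ≤ 2 ^ k := Nat.one_le_two_pow
  rw [h16, coveringSteps, roundSteps, testSteps]
  generalize 2 ^ k = X at hX
  generalize r * k = w
  have h1 : X * (15 * w + 18) + 15 * w + 20 + 2 ≤ X * (30 * w + 40) := by nlinarith
  have h2 : X * (X * (15 * w + 18) + 15 * w + 20 + 2) + 12 ≤ X * (X * (30 * w + 52)) := by
    nlinarith
  have h3 : X * (X * (X * (15 * w + 18) + 15 * w + 20 + 2) + 12) + 10 + 7 ≤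
      X * (X * (X * (30 * w + 69))) := by
    have : 1 ≤ X * (X * X) := Nat.mul_pos hX (Nat.mul_pos hX hX)
    nlinarith [Nat.mul_le_mul_left X h2]
  have h4 : 1 ≤ X * (X * (X * X)) := Nat.mul_pos hX (Nat.mul_pos hX (Nat.mul_pos hX hX))
  nlinarith [Nat.mul_le_mul_left X h3]

lemma oStar_of_le {f : ℕ → ℕ} {c C : ℝ} {d : ℕ} (hc : 0 ≤ c)
    (h : ∀ n, (f n : ℝ) ≤ C * ((n : ℝ) + 1) ^ d * c ^ n) : OStar f c := by
  refine ⟨d, Asymptotics.IsBigO.of_bound (|C| * 2 ^ d) ?_⟩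
  filter_upwards [Filter.eventually_ge_atTop 1] with n hn
  have hn' : (1 : ℝ) ≤ n := by exact_mod_cast hn
  rw [Real.norm_of_nonneg (by positivity), Real.norm_of_nonneg (by positivity)]
  calc (f n : ℝ) ≤ C * ((n : ℝ) + 1) ^ d * c ^ n := h n
    _ ≤ |C| * (2 * (n : ℝ)) ^ d * c ^ n := by
        gcongr
        · exact le_abs_self C
        · linarith
    _ = _ := by rw [mul_pow]; ring

lemma exists_coveringLength_le {α : ℝ} (hα : 1 ≤ α) :
    ∃ κ : ℕ, ∀ k, (coveringLength α k : ℝ) ≤ κ * ((k : ℝ) + 1) ^ 2 * brute α ^ k := by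
  obtain ⟨κ, hκ⟩ := exists_sum_choose_div_choose_le hα
  refine ⟨κ + 1, fun k => ?_⟩
  have hb : (1 : ℝ) ≤ brute α ^ k := one_le_pow₀ (one_lt_brute α).le
  have hW : coverWeight α k ≤ κ * (k + 1) * brute α ^ k := hκ k
  have hW0 : 0 ≤ coverWeight α k := zero_le_one.trans (one_le_coverWeight α k)
  calc (coveringLength α k : ℝ) ≤ coverWeight α k * k + 1 := Nat.floor_le (by positivity)
    _ ≤ κ * (k + 1) * brute α ^ k * (k + 1) + 1 * brute α ^ k := by
        gcongr
        · linarith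
        · linarith
    _ ≤ κ * (k + 1) * brute α ^ k * (k + 1) + ((k : ℝ) + 1) ^ 2 * brute α ^ k := by
        gcongr
        exact one_le_pow₀ (by linarith [(Nat.cast_nonneg k : (0 : ℝ) ≤ k)])
    _ = _ := by push_cast; ring

/-- The greedy phase costs 16^k ≤ `brute α ^ (r * k)` up to a polynomial. The search costs the r-th
power of the list length, where the polynomial factor stays polynomial because r is constant. -/
lemma oStar_runningTime {α : ℝ} (hα : 1 ≤ α) {r : ℕ} (hr : 0 < r) (h16 : 16 ≤ brute α ^ r) :
    OStar (runningTime α r) (brute α) := by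
  obtain ⟨κ, hκ⟩ := exists_coveringLength_le hα
  have hb1 : 1 ≤ brute α := (one_lt_brute α).le
  set K := ⌈α⌉₊ + r + 60 with hK
  -- The degree is 2r from the r-th power of the quadratic factor in the list length, plus one for
  -- the linear cost of a trial and one for the word length.
  refine oStar_of_le (d := 2 * r + 2)
    (C := (15 + (30 * r + 73) + (5 * r + 10) + (4 * κ) ^ r * (27 * r + 28)) *
      (2 * r + 2 * K + 1) * brute α ^ r) (by linarith) fun n => ?_
  obtain ⟨k, hk⟩ : ∃ k, k = n / r + 1 := ⟨_, rfl⟩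
  set A := brute α ^ (r * k) with hA
  have hA1 : 1 ≤ A := one_le_pow₀ hb1
  -- Rounding the block size up adds at most r elements, which costs only a constant factor.
  have hAle : A ≤ brute α ^ r * brute α ^ n := by
    rw [← pow_add]
    refine pow_le_pow_right₀ hb1 ?_
    rw [hk, mul_add, mul_one]
    have := Nat.mul_div_le n r
    omega
  set N : ℝ := (n : ℝ) + 1 with hN
  have hN1 : 1 ≤ N := by rw [hN]; linarith [(Nat.cast_nonneg n : (0 : ℝ) ≤ n)]
  have hkN : (k : ℝ) ≤ N := by
    have : k ≤ n + 1 := by rw [hk]; exact Nat.succ_le_succ (Nat.div_le_self n r)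
    rw [hN]; exact_mod_cast this
  have hk0 : (0 : ℝ) ≤ k := Nat.cast_nonneg k
  have hr0 : (0 : ℝ) ≤ r := Nat.cast_nonneg r
  have hpow : (16 : ℝ) ^ k ≤ A := by
    rw [hA, pow_mul]; gcongr
  have hlen : (coveringLength α k : ℝ) ^ r ≤ (4 * κ) ^ r * N ^ (2 * r) * A := by
    calc (coveringLength α k : ℝ) ^ r ≤ (κ * ((k : ℝ) + 1) ^ 2 * brute α ^ k) ^ r := by
          gcongr; exact hκ k
      _ ≤ (κ * (2 * N) ^ 2 * brute α ^ k) ^ r := by gcongr; linarith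
      _ = (4 * κ * N ^ 2 * brute α ^ k) ^ r := by ring
      _ = _ := by rw [hA, mul_comm r k, mul_pow, mul_pow, ← pow_mul, ← pow_mul]
  have hcov : (coveringSteps r k : ℝ) ≤ A * (30 * (r * k) + 73) := by
    have h : (coveringSteps r k : ℝ) ≤ 16 ^ k * (30 * (r * k) + 73) := by
      exact_mod_cast coveringSteps_le r k
    exact h.trans (by gcongr)
  have hNr : 1 ≤ N ^ (2 * r) := one_le_pow₀ hN1
  have hrk : (r : ℝ) * k ≤ r * N := by gcongr
  set E := A * N ^ (2 * r) * N with hE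
  have hE1 : N ≤ E := by
    rw [hE]
    exact le_mul_of_one_le_left (by linarith) (one_le_mul_of_one_le_of_one_le hA1 hNr)
  have hE2 : A * N ≤ E := by
    rw [hE]
    exact mul_le_mul_of_nonneg_right (le_mul_of_one_le_right (by linarith) hNr) (by linarith)
  have t1 : 4 * (k : ℝ) + 11 ≤ 15 * E := by linarith
  have t2 : (coveringSteps r k : ℝ) ≤ (30 * r + 73) * E := by
    calc (coveringSteps r k : ℝ) ≤ A * (30 * (r * k) + 73) := hcov
      _ ≤ A * ((30 * r + 73) * N) := by gcongr; linarith
      _ = (30 * r + 73) * (A * N) := by ring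
      _ ≤ _ := by gcongr
  have t3 : (searchSteps r k (coveringLength α k) : ℝ) ≤
      (4 * κ) ^ r * (27 * r + 28) * E + (5 * r + 10) * E := by
    rw [searchSteps]
    push_cast
    have s1 : (coveringLength α k : ℝ) ^ r * (15 * (r * k) + 12 * r + 28) ≤
        (4 * κ) ^ r * (27 * r + 28) * E := by
      calc (coveringLength α k : ℝ) ^ r * (15 * (r * k) + 12 * r + 28)
          ≤ ((4 * κ) ^ r * N ^ (2 * r) * A) * ((27 * r + 28) * N) := by
            gcongr
            nlinarith
        _ = _ := by rw [hE]; ring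
    have s2 : 5 * (r : ℝ) + 10 ≤ (5 * r + 10) * E :=
      le_mul_of_one_le_right (by positivity) (by linarith)
    linarith
  have t4 : 2 * (wordLength α r k : ℝ) + 1 ≤ (2 * r + 2 * K + 1) * N := by
    rw [wordLength, ← hK]
    push_cast
    have : (0 : ℝ) ≤ K := Nat.cast_nonneg K
    nlinarith
  calc (runningTime α r n : ℝ)
      = (4 * (k : ℝ) + 11 + (coveringSteps r k + searchSteps r k (coveringLength α k))) *
          (2 * wordLength α r k + 1) := by
        rw [runningTime, ← hk]; push_cast; ring
    _ ≤ ((15 + (30 * r + 73) + (5 * r + 10) + (4 * κ) ^ r * (27 * r + 28)) * E) *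
          ((2 * r + 2 * K + 1) * N) := by
        gcongr
        linarith
    _ = (15 + (30 * r + 73) + (5 * r + 10) + (4 * κ) ^ r * (27 * r + 28)) *
          (2 * r + 2 * K + 1) * N ^ (2 * r + 2) * A := by rw [hE]; ring
    _ ≤ (15 + (30 * r + 73) + (5 * r + 10) + (4 * κ) ^ r * (27 * r + 28)) *
          (2 * r + 2 * K + 1) * N ^ (2 * r + 2) * (brute α ^ r * brute α ^ n) := by gcongr
    _ = _ := by ring

end OracleMinSubset

theorem theorem4 (α : ℝ) (hα : 1 ≤ α) :
    (∃ (P : OracleMinSubset.Program) (T : ℕ → ℕ),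
      OracleMinSubset.IsDeterministicApprox α P T ∧
      OracleMinSubset.OStar T (OracleMinSubset.brute α)) ∧
    (∀ c : ℝ, 0 ≤ c → c < OracleMinSubset.brute α →
      ¬ ∃ (A : OracleMinSubset.RandomizedAlgorithm) (q : ℕ → ℕ),
        OracleMinSubset.IsRandomizedApprox α A ∧
        OracleMinSubset.UsesAtMostQueries A q ∧
        OracleMinSubset.OStar q c) := by
  refine ⟨?_, ?_⟩
  -- The number of blocks depends on α only, so it can be hardwired into the program.
  · obtain ⟨r, hr⟩ := pow_unbounded_of_one_lt 16 (OracleMinSubset.one_lt_brute α)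
    have hr0 : 0 < r := by
      rcases Nat.eq_zero_or_pos r with rfl | h
      · norm_num at hr
      · exact h
    exact ⟨_, _, OracleMinSubset.isDeterministicApprox_coveringSearch hα hr0,
      OracleMinSubset.oStar_runningTime hα hr0 hr.le⟩
  · rintro c hc0 hc ⟨A, q, hA, hq, hO⟩
    exact OracleMinSubset.not_oStar_of_isRandomizedApprox hα hc0 hc hA hq hO
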